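/- **Conventions.** A \emph{tree} is a set $T\subseteq\mathbb N_{>0}^*$ containing $\varepsilon$ (the root) such that $x\cdot c\in T$ implies $x\in T$ and $x\cdot c'\in T$ for all $0<c'<c$; the branching degree of $x\in T$ is the (possibly infinite) number of its children $x\cdot c\in T$. A $\Sigma$-labeled tree is a tree $T$ with a map $V:T\to\Sigma$. $\mathcal B^+(X)$ is the set of positive Boolean formulas over $X$ (built from true, false and elements of $X$ by $\wedge,\vee$). A \emph{symmetric $k$-weak-pebble alternating tree automaton} has a finite state set $Q$, a finite alphabet $\Sigma$, an initial state $q^0\in Q$ and a transition function $$\delta:Q\times\Sigma\times\{\mathrm{false},\mathrm{true}\}\to(\{\mathrm{drop},\mathrm{lift}\}\times Q)\cup\mathcal B^+(\{\Box,\Diamond,-1,0,\mathrm{root}\}\times Q)$$ such that $\delta(q,\sigma,\mathrm{false})$ is never of the form $(\mathrm{lift},p)$ and $\delta(q,\sigma,\mathrm{true})$ contains no tuple $(-1,p)$. A configuration $(q,x,\bar y)$ consists of a state, a node and a stack $\bar y$ of at most $k$ nodes (the placed pebbles). A \emph{run} on $(T,V)$ is a tree labeled by configurations, with root labeled $(q^0,\varepsilon,\text{empty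 stack})$, such that for every node $v$ labeled $(q,x,\bar y)$, with $b$ being true iff the last placed pebble lies on $x$: if $\delta(q,V(x),b)=(\mathrm{drop},p)$, then fewer than $k$ pebbles are placed and the children of $v$ (at least one) are labeled $(p,x,\bar y')$ where $\bar y'$ is $\bar y$ with $x$ pushed; if $\delta(q,V(x),b)=(\mathrm{lift},p)$, then the children of $v$ (at least one) are labeled $(p,x,\bar y')$ where $\bar y'$ is $\bar y$ with its last pebble (which lies on $x$) removed; if $\delta(q,V(x),b)=\alpha\in\mathcal B^+(\cdot)$, then there is a set $Y$ of tuples occurring in $\alpha$ that satisfies $\alpha$ such that for each $(\Diamond,p)\in Y$ some child of $v$ is labeled $(p,x\cdot c,\bar y)$ for some child $x\cdot c$ of $x$, for each $(\Box,p)\in Y$ and each child $x\cdot c$ of $x$ some child of $v$ is labeled $(p,x\cdot c,\bar y)$, for each $(-1,p)\in Y$ the node $x$ is not the root and some child of $v$ is labeled by $p$, the parent of $x$, and $\bar y$, for each $(0,p)\in Y$ some child of $v$ is labeled $(p,x,\bar y)$, for each $(\mathrm{root},p)\in Y$ we have $x=\varepsilon$ and some child of $v$ is labeled $(p,x,\bar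 y)$, and every child of $v$ carries a label that arises from a tuple of $Y$ in this way. The automaton is \emph{hesitant} if it comes with sets $G,B\subseteq Q$, a partition $Q_1,\dots,Q_m$ of $Q$ with every $Q_i$ classified as existential, universal or transient, and a partial order on the sets $Q_i$ such that, for $q\in Q_i$: every state occurring in $\delta(q,\sigma,b)$ lies in $Q_i$ or in some $Q_j<Q_i$; if $Q_i$ is transient, no state of $Q_i$ occurs in $\delta(q,\sigma,b)$; if $Q_i$ is existential (universal), then the tuples with states from $Q_i$ in a Boolean combination $\delta(q,\sigma,b)$ are only disjunctively (conjunctively) related, i.e. no two different ones stand on different sides of a conjunction (disjunction), and none of them has direction $\Box$ (direction $\Diamond$). A run is \emph{accepting} if every infinite path from its root either is eventually trapped in an existential $Q_i$ and visits states of $G$ infinitely often, or is eventually trapped in a universal $Q_i$ and visits states of $B$ only finitely often, and every leaf of the run is labeled by a configuration at which the transition is a Boolean combination equivalent to true. The automaton accepts $(T,V)$ if it has an accepting run on $(T,V)$. **Proposition.** Let $k\ge 0$ and let $A$ be a symmetric $k$-weak-pebble hesitant alternating tree automaton with $n$ states. If $A$ accepts some labeled tree, then $A$ accepts a labeled tree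 in which every node has at most $2^{n^2(k+1)}$ children. -/

import Mathlib

namespace PebbleTree

/-! ### Trees -/

/-- A node is a finite string of child numbers.  The string `x · c` (the child number `c` of the
node `x`) is stored as `c :: x`, so the last letter comes first and the parent of `c :: x` is `x`;
the empty string `[]` is the root.  Children are numbered from `0` on. -/
abbrev Node := List ℕ

/-- A labeled tree: a set of nodes that contains the root, is closed under parents and, together
with a child, contains all its smaller siblings; and a labeling.  Nodes may have no child, finitely
many or infinitely many children.  Only the labels of nodes of the tree matter. -/
structure LTree (S : Type*) where
  nodes : Set Node
  label : Node → S
  root_mem : [] ∈ nodes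
  parent_mem : ∀ (x : Node) (c : ℕ), c :: x ∈ nodes → x ∈ nodes
  sibling_mem : ∀ (x : Node) (c c' : ℕ), c :: x ∈ nodes → c' < c → c' :: x ∈ nodes

namespace LTree

variable {S : Type*}

/-- The children of `x` in the tree. -/
def children (t : LTree S) (x : Node) : Set Node :=
  {z | z ∈ t.nodes ∧ ∃ c : ℕ, z = c :: x}

/-- The branching degree of a node: the number of its children, possibly infinite. -/
noncomputable def degree (t : LTree S) (x : Node) : ℕ∞ :=
  (t.children x).encard

/-- An infinite path, starting at the root. -/
def IsInfinitePath (t : LTree S) (π : ℕ → Node) : Prop :=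
  π 0 = [] ∧ ∀ n, π (n + 1) ∈ t.children (π n)

end LTree

/-! ### Positive Boolean formulas -/

/-- Positive Boolean formulas over `X`. -/
inductive PBF (X : Type*) where
  | tt : PBF X
  | ff : PBF X
  | var (a : X) : PBF X
  | and (α β : PBF X) : PBF X
  | or (α β : PBF X) : PBF X

namespace PBF

variable {X : Type*}

/-- `α.Sat Y`: the formula `α` becomes true when exactly the elements of `Y` are set to true. -/
def Sat (Y : Set X) : PBF X → Prop
  | tt => True
  | ff => False
  | var a => a ∈ Y
  | and α β => α.Sat Y ∧ β.Sat Y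
  | or α β => α.Sat Y ∨ β.Sat Y

/-- The elements of `X` that occur in a formula. -/
def atoms : PBF X → Set X
  | tt => ∅
  | ff => ∅
  | var a => {a}
  | and α β => α.atoms ∪ β.atoms
  | or α β => α.atoms ∪ β.atoms

/-- The elements of `P` occurring in the formula are only disjunctively related: no two different
ones occur on the two sides of a conjunction. -/
def DisjRelated (P : Set X) : PBF X → Prop
  | tt => True
  | ff => True
  | var _ => True
  | and α β => α.DisjRelated P ∧ β.DisjRelated P ∧
      ∀ a ∈ α.atoms ∩ P, ∀ b ∈ β.atoms ∩ P, a = b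
  | or α β => α.DisjRelated P ∧ β.DisjRelated P

/-- The elements of `P` occurring in the formula are only conjunctively related: no two different
ones occur on the two sides of a disjunction. -/
def ConjRelated (P : Set X) : PBF X → Prop
  | tt => True
  | ff => True
  | var _ => True
  | and α β => α.ConjRelated P ∧ β.ConjRelated P
  | or α β => α.ConjRelated P ∧ β.ConjRelated P ∧
      ∀ a ∈ α.atoms ∩ P, ∀ b ∈ β.atoms ∩ P, a = b

end PBF

/-! ### Symmetric weak-pebble alternating tree automata -/

/-- The directions `□`, `◇`, `-1`, `0` and `root`. -/
inductive Dir where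
  | box
  | dia
  | up
  | stay
  | root

/-- The possible values of a transition function: drop a pebble, lift the last pebble, or a
positive Boolean combination of moves. -/
inductive Trans (Q : Type*) where
  | drop (p : Q) : Trans Q
  | lift (p : Q) : Trans Q
  | form (α : PBF (Dir × Q)) : Trans Q

/-- The states occurring in a transition. -/
def Trans.states {Q : Type*} : Trans Q → Set Q
  | drop p => {p}
  | lift p => {p}
  | form α => {p | ∃ d, (d, p) ∈ α.atoms}

/-- A symmetric `k`-weak-pebble alternating tree automaton with states `Q` over the alphabet `S`,
without its acceptance condition.  The Boolean argument of `δ` tells whether the last placed pebble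
lies on the current node. -/
structure SymWPAA (k : ℕ) (Q S : Type*) where
  init : Q
  δ : Q → S → Bool → Trans Q
  no_lift : ∀ q σ p, δ q σ false ≠ Trans.lift p
  no_up : ∀ q σ α p, δ q σ true = Trans.form α → (Dir.up, p) ∉ α.atoms

/-- A configuration: a state, a position in the tree and the pebble placement.  Pebbles are used in
a stack-wise fashion, so a placement is the list of the positions of the placed pebbles, the last
placed pebble coming first. -/
structure Config (Q : Type*) where
  state : Q
  pos : Node
  pebbles : List Node

/-- Does the last placed pebble lie on the current position? -/
def Config.onPebble {Q : Type*} (c : Config Q) : Bool :=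
  decide (c.pebbles.head? = some c.pos)

/-- The nodes of `t` that a tuple with direction `d` refers to at the node `x`. -/
def targets {S : Type*} (t : LTree S) (x : Node) : Dir → Set Node
  | Dir.box => t.children x
  | Dir.dia => t.children x
  | Dir.up => {z | ∃ c : ℕ, x = c :: z}
  | Dir.stay => {x}
  | Dir.root => {z | z = x ∧ x = []}

namespace SymWPAA

variable {k : ℕ} {Q S : Type*}

/-- The transition that applies in a configuration. -/
def transAt (A : SymWPAA k Q S) (t : LTree S) (c : Config Q) : Trans Q :=
  A.δ c.state (t.label c.pos) c.onPebble

/-- `A.Step t c L`: in a run on `t`, a node labeled by `c` may have children whose set of labels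
is `L`.
A pebble can be dropped only if not all `k` pebbles are placed; the last pebble can be lifted only
at its position.  In the case of a Boolean combination `α`, a set `Y` of tuples of `α` satisfying
`α` is chosen; a tuple with direction `-1` may be chosen only below the root and a tuple with
direction `root` only at the root; a tuple `(□, p)` asks for a child for every child of the current
node, every other tuple for one child; and there are no further children. -/
def Step (A : SymWPAA k Q S) (t : LTree S) (c : Config Q) (L : Set (Config Q)) : Prop :=
  match A.transAt t c with
  | Trans.drop p => c.pebbles.length < k ∧ L = {⟨p, c.pos, c.pos :: c.pebbles⟩}
  | Trans.lift p => c.pebbles.head? = some c.pos ∧ L = {⟨p, c.pos, c.pebbles.tail⟩}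
  | Trans.form α => ∃ Y : Set (Dir × Q), Y ⊆ α.atoms ∧ α.Sat Y ∧
      (∀ d p, (d, p) ∈ Y → d ≠ Dir.box →
        ∃ z ∈ targets t c.pos d, (⟨p, z, c.pebbles⟩ : Config Q) ∈ L) ∧
      (∀ p, (Dir.box, p) ∈ Y →
        ∀ z ∈ targets t c.pos Dir.box, (⟨p, z, c.pebbles⟩ : Config Q) ∈ L) ∧
      (∀ c' ∈ L, ∃ d p, (d, p) ∈ Y ∧ ∃ z ∈ targets t c.pos d, c' = ⟨p, z, c.pebbles⟩)

/-- A run of `A` on `t`: a tree labeled by configurations that starts in the initial state at the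
root without placed pebbles and is compatible with the transition function. -/
structure IsRun (A : SymWPAA k Q S) (t : LTree S) (r : LTree (Config Q)) : Prop where
  start : r.label [] = ⟨A.init, [], []⟩
  step : ∀ v ∈ r.nodes, A.Step t (r.label v) (r.label '' r.children v)

/-- The transition that applies in `c` is the Boolean combination `true`, up to equivalence (a
positive formula is equivalent to `true` iff the empty set satisfies it). -/
def TrueApplies (A : SymWPAA k Q S) (t : LTree S) (c : Config Q) : Prop :=
  ∃ α, A.transAt t c = Trans.form α ∧ α.Sat ∅

end SymWPAA

/-! ### Hesitant automata -/

/-- The three kinds of sets in the partition of the states of a hesitant automaton. -/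
inductive Kind where
  | existential
  | universal
  | transient

/-- A symmetric `k`-weak-pebble hesitant alternating tree automaton.  The partition of the states
into the sets `Q_1, …, Q_m` is given by the map `part` sending a state to the index of its set. -/
structure SymWPHAA (k : ℕ) (Q S : Type*) extends SymWPAA k Q S where
  G : Set Q
  B : Set Q
  m : ℕ
  part : Q → Fin m
  kind : Fin m → Kind
  le : Fin m → Fin m → Prop
  le_refl : ∀ i, le i i
  le_trans : ∀ i j l, le i j → le j l → le i l
  le_antisymm : ∀ i j, le i j → le j i → i = j
  /-- Transitions lead to the same set or to a smaller one. -/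
  descend : ∀ q σ b, ∀ p ∈ (δ q σ b).states, le (part p) (part q)
  transient_leave : ∀ q σ b, kind (part q) = Kind.transient →
    ∀ p ∈ (δ q σ b).states, part p ≠ part q
  existential_disj : ∀ q σ b α, kind (part q) = Kind.existential → δ q σ b = Trans.form α →
    α.DisjRelated {a | part a.2 = part q}
  universal_conj : ∀ q σ b α, kind (part q) = Kind.universal → δ q σ b = Trans.form α →
    α.ConjRelated {a | part a.2 = part q}
  existential_no_box : ∀ q σ b α p, kind (part q) = Kind.existential →
    δ q σ b = Trans.form α → part p = part q → (Dir.box, p) ∉ α.atoms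
  universal_no_dia : ∀ q σ b α p, kind (part q) = Kind.universal →
    δ q σ b = Trans.form α → part p = part q → (Dir.dia, p) ∉ α.atoms

/-- The states that occur infinitely often in a sequence of states. -/
def infStates {Q : Type*} (s : ℕ → Q) : Set Q :=
  {q | ∀ N, ∃ n, N ≤ n ∧ s n = q}

namespace SymWPHAA

variable {k : ℕ} {Q S : Type*}

/-- The acceptance condition on the sequence of states along an infinite path: the path gets
trapped in an existential set and visits `G` infinitely often, or it gets trapped in a universal
set and visits `B` only finitely often. -/
def AcceptsSeq (A : SymWPHAA k Q S) (s : ℕ → Q) : Prop :=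
  ∃ i : Fin A.m, (∃ N, ∀ n, N ≤ n → A.part (s n) = i) ∧
    ((A.kind i = Kind.existential ∧ (infStates s ∩ A.G).Nonempty) ∨
      (A.kind i = Kind.universal ∧ infStates s ∩ A.B = ∅))

/-- An accepting run: every infinite path satisfies the acceptance condition, and every finite path
ends in a configuration where a transition to `true` applies. -/
structure IsAcceptingRun (A : SymWPHAA k Q S) (t : LTree S) (r : LTree (Config Q)) : Prop where
  isRun : A.IsRun t r
  infinite_path : ∀ π, r.IsInfinitePath π → A.AcceptsSeq fun n => (r.label (π n)).state
  finite_path : ∀ v ∈ r.nodes, r.children v = ∅ → A.TrueApplies t (r.label v)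

/-- The language of the automaton: the set of labeled trees that it accepts. -/
def language (A : SymWPHAA k Q S) : Set (LTree S) :=
  {t | ∃ r, A.IsAcceptingRun t r}

end SymWPHAA

end PebbleTree

/-!
From a tree `t` accepted by `A`, a new tree is built in which every node stands for a node of `t`
and has either no child or exactly `N = 2 ^ (n ^ 2 * (k + 1))` children; these stand for (not
necessarily distinct) chosen children of that node.  An accepting run on `t` survives the passage to
fewer children except for its `◇`-moves, which have to be redirected to chosen children.  So the
question is which children to choose.

*Locality.*  A pebble automaton cannot go up from its last pebble.  Hence a visit to the subtree of
a child of `x`, with pebbles `ys` placed outside of the subtree, ends only by returning to `x` with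
exactly these pebbles, and inside the subtree the places of `ys` do not matter.  All that matters is
the number `i ≤ k` of pebbles and the set `W` of states `p` for which `(p, x, ys)` is winning
(`Good.local`, `Win.local`).

*Progress.*  In an existential part a run need follow only one path (`Good.exists_thin`), so a
winning configuration there has a finite distance to success, that is, to visiting `G` or leaving
the part (`Win.exists_succeedsIn`).  A redirected `◇`-move must not increase this distance.  The
shortest path to success from the child either succeeds inside the subtree of the child or returns
to `x` in some state `p' ∈ W`.  In the first case the move goes to the child with the shortest path
that succeeds inside, in the second one to the child with the shortest path that returns in `p'`;
by locality both children depend only on `i`, `W`, the state `p` in which the child is entered and,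
in the second case, `p'` (`exists_isBest`, `exists_redirect`).

*Counting.*  Since `W` contains the state from which the move starts, it is nonempty, and so
`(k + 1) * n * ∑ (|W| + 1)`, the sum over all nonempty `W`, choices suffice.  This is at most `N`
(`card_tasks_le`).

*The new run.*  On the new tree, the run follows accepting runs on `t` through the universal parts,
where no `◇`-move stays in the part and nothing is redirected, and it takes optimal steps in the
existential parts, where every step visits `G` or comes closer to success (`win_selTree`).  No
positional determinacy is needed: the run remembers a node of an accepting run on `t`.
-/

namespace PebbleTree

/-! ### Acceptance along sequences of states -/

namespace SymWPHAA

variable {k : ℕ} {Q S : Type*}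

/-- Acceptance does not depend on the first state of the sequence. -/
theorem acceptsSeq_succ_iff (A : SymWPHAA k Q S) (s : ℕ → Q) :
    A.AcceptsSeq (fun n => s (n + 1)) ↔ A.AcceptsSeq s := by
  have hinf : infStates (fun n => s (n + 1)) = infStates s := by
    ext q
    constructor
    · intro h N
      obtain ⟨n, hn, h'⟩ := h N
      exact ⟨n + 1, by omega, h'⟩
    · intro h N
      obtain ⟨n, hn, h'⟩ := h (N + 1)
      refine ⟨n - 1, by omega, ?_⟩
      have : n - 1 + 1 = n := by omega
      simpa only [this] using h'
  have htrap : ∀ i, (∃ N, ∀ n, N ≤ n → A.part (s (n + 1)) = i) ↔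
      ∃ N, ∀ n, N ≤ n → A.part (s n) = i := by
    intro i
    constructor
    · rintro ⟨N, h⟩
      refine ⟨N + 1, fun n hn => ?_⟩
      have : n - 1 + 1 = n := by omega
      simpa only [this] using h (n - 1) (by omega)
    · rintro ⟨N, h⟩
      exact ⟨N, fun n hn => h _ (by omega)⟩
  simp only [AcceptsSeq, hinf, htrap]

theorem acceptsSeq_add_iff (A : SymWPHAA k Q S) (s : ℕ → Q) (N : ℕ) :
    A.AcceptsSeq (fun n => s (n + N)) ↔ A.AcceptsSeq s := by
  induction N with
  | zero => rfl
  | succ N ih =>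
    rw [← ih, ← A.acceptsSeq_succ_iff (fun n => s (n + N))]
    simp only [add_assoc, add_comm 1]

/-- The index of the current part of the partition is eventually constant along a sequence of states
in which it never increases. -/
theorem exists_trapped (A : SymWPHAA k Q S) (s : ℕ → Q)
    (h : ∀ n, A.le (A.part (s (n + 1))) (A.part (s n))) :
    ∃ N, ∀ n, N ≤ n → A.part (s n) = A.part (s N) := by
  let lt : Fin A.m → Fin A.m → Prop := fun i j => A.le i j ∧ i ≠ j
  have htrans : IsTrans _ lt := ⟨fun i j l hij hjl => ⟨A.le_trans _ _ _ hij.1 hjl.1, by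
    rintro rfl
    exact hij.2 (A.le_antisymm _ _ hij.1 hjl.1)⟩⟩
  have hirrefl : Std.Irrefl lt := ⟨fun i h => h.2 rfl⟩
  obtain ⟨_, ⟨N, rfl⟩, hN⟩ := (Finite.wellFounded_of_trans_of_irrefl lt).has_min
    (Set.range fun n => A.part (s n)) (Set.range_nonempty _)
  refine ⟨N, fun n hn => ?_⟩
  have hle : A.le (A.part (s n)) (A.part (s N)) := by
    induction n, hn using Nat.le_induction with
    | base => exact A.le_refl _
    | succ n _ ih => exact A.le_trans _ _ _ (h n) ih
  by_contra hne
  exact hN _ ⟨n, rfl⟩ ⟨hle, hne⟩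

end SymWPHAA

/-! ### Winning configurations -/

theorem Config.countable {Q : Type*} [Countable Q] : Countable (Config Q) := by
  have : Function.Injective (fun c : Config Q => (c.state, c.pos, c.pebbles)) := by
    rintro ⟨a, b, c⟩ ⟨a', b', c'⟩ h
    simpa using h
  exact this.countable

namespace SymWPHAA

variable {k : ℕ} {Q S : Type*}

/-- `r` is an accepting run, except that it starts in the configuration `C`. -/
structure AcceptingFrom (A : SymWPHAA k Q S) (t : LTree S) (C : Config Q)
    (r : LTree (Config Q)) : Prop where
  start : r.label [] = C
  step : ∀ v ∈ r.nodes, A.Step t (r.label v) (r.label '' r.children v)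
  infinite_path : ∀ π, r.IsInfinitePath π → A.AcceptsSeq fun n => (r.label (π n)).state
  finite_path : ∀ v ∈ r.nodes, r.children v = ∅ → A.TrueApplies t (r.label v)

/-- `C` is winning: there is an accepting run from `C`. -/
def Win (A : SymWPHAA k Q S) (t : LTree S) (C : Config Q) : Prop :=
  ∃ r, A.AcceptingFrom t C r

/-- A step that is allowed in an accepting run: it ends the run only where `true` applies. -/
def Good (A : SymWPHAA k Q S) (t : LTree S) (C : Config Q) (L : Set (Config Q)) : Prop :=
  A.Step t C L ∧ (L = ∅ → A.TrueApplies t C)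

/-- A step into winning configurations only. -/
def WinStep (A : SymWPHAA k Q S) (t : LTree S) (C : Config Q) (L : Set (Config Q)) : Prop :=
  A.Good t C L ∧ ∀ c ∈ L, A.Win t c

theorem AcceptingFrom.good {A : SymWPHAA k Q S} {t : LTree S} {C : Config Q}
    {r : LTree (Config Q)} (h : A.AcceptingFrom t C r) {v : Node} (hv : v ∈ r.nodes) :
    A.Good t (r.label v) (r.label '' r.children v) :=
  ⟨h.step v hv, fun h0 => h.finite_path v hv (by simpa using h0)⟩

/-- In an accepting run, infinite paths from every node satisfy the acceptance condition. -/
theorem AcceptingFrom.path_from {A : SymWPHAA k Q S} {t : LTree S} {C : Config Q}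
    {r : LTree (Config Q)} (h : A.AcceptingFrom t C r) (v : Node) :
    ∀ π : ℕ → Node, π 0 = v → (∀ n, π (n + 1) ∈ r.children (π n)) →
      A.AcceptsSeq fun n => (r.label (π n)).state := by
  induction v with
  | nil => exact fun π h0 hπ => h.infinite_path π ⟨h0, hπ⟩
  | cons a u ih =>
    intro π h0 hπ
    have hmem : a :: u ∈ r.nodes := by
      obtain ⟨hm, c, hc⟩ := hπ 0
      exact r.parent_mem _ c (by rw [← h0, ← hc]; exact hm)
    have := ih (fun n => Nat.casesOn n u π) rfl (by
      rintro (_ | n)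
      · exact ⟨by simpa [h0] using hmem, a, h0⟩
      · exact hπ n)
    exact (A.acceptsSeq_succ_iff _).2 this

/-- An accepting run may be given as a graph: every vertex has a good step into labels of its
successors, and all infinite paths satisfy the acceptance condition. -/
theorem win_of_graph_aux [Countable Q] (A : SymWPHAA k Q S) (t : LTree S) {V : Type*}
    (lab : V → Config Q) (E : V → V → Prop)
    (hstep : ∀ v, ∃ L, A.Good t (lab v) L ∧ ∀ c ∈ L, ∃ v', E v v' ∧ lab v' = c)
    (hpath : ∀ π : ℕ → V, (∀ n, E (π n) (π (n + 1))) → A.AcceptsSeq fun n => (lab (π n)).state)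
    (v₀ : V) : A.Win t (lab v₀) := by
  have := Config.countable (Q := Q)
  choose L hL hE using hstep
  -- A nonempty set of labels is countable, so it can be spread over the child numbers `0, 1, …`.
  have hnext : ∀ v, ∃ f : ℕ → V, (L v).Nonempty →
      (∀ n, E v (f n)) ∧ L v = Set.range fun n => lab (f n) := by
    intro v
    by_cases hne : (L v).Nonempty
    · obtain ⟨e, he⟩ := (Set.to_countable (L v)).exists_eq_range hne
      have : ∀ n, ∃ v', E v v' ∧ lab v' = e n := fun n =>
        hE v (e n) (he ▸ Set.mem_range_self n)
      choose f hf hf' using this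
      exact ⟨f, fun _ => ⟨hf, by simp only [hf']; exact he⟩⟩
    · exact ⟨fun _ => v, fun h => absurd h hne⟩
  choose next hnext using hnext
  let walk : Node → V := fun x => List.rec v₀ (fun n _ v => next v n) x
  let alive : Node → Prop := fun x => List.rec True (fun _ y h => h ∧ (L (walk y)).Nonempty) x
  let r : LTree (Config Q) :=
    { nodes := {x | alive x}
      label := fun x => lab (walk x)
      root_mem := trivial
      parent_mem := fun x c h => h.1
      sibling_mem := fun x c c' h _ => h }
  have hch : ∀ v ∈ r.nodes, r.label '' r.children v = L (walk v) := by
    intro v hv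
    ext c
    constructor
    · rintro ⟨_, ⟨hm, n, rfl⟩, rfl⟩
      have h2 : (L (walk v)).Nonempty := And.right (show alive (n :: v) from hm)
      rw [(hnext _ h2).2]
      exact ⟨n, rfl⟩
    · intro hc
      have hne : (L (walk v)).Nonempty := ⟨c, hc⟩
      rw [(hnext _ hne).2] at hc
      obtain ⟨n, rfl⟩ := hc
      exact ⟨n :: v, ⟨⟨hv, hne⟩, n, rfl⟩, rfl⟩
  refine ⟨r, rfl, ?_, ?_, ?_⟩
  · intro v hv
    rw [hch v hv]
    exact (hL _).1
  · rintro π ⟨-, hπ⟩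
    refine hpath (fun n => walk (π n)) fun n => ?_
    obtain ⟨hm, c, hc⟩ := hπ n
    have hm' : alive (π (n + 1)) := hm
    change E (walk (π n)) (walk (π (n + 1)))
    rw [hc] at hm' ⊢
    exact (hnext _ hm'.2).1 c
  · intro v hv h0
    have := hch v hv
    rw [h0, Set.image_empty] at this
    exact (hL _).2 this.symm

/-- In a graph that describes an accepting run, it suffices to continue up to winning
configurations, where some accepting run takes over. -/
theorem win_of_graph [Countable Q] (A : SymWPHAA k Q S) (t : LTree S) {V : Type*}
    (lab : V → Config Q) (E : V → V → Prop)
    (hstep : ∀ v, ∃ L, A.Good t (lab v) L ∧ ∀ c ∈ L, A.Win t c ∨ ∃ v', E v v' ∧ lab v' = c)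
    (hpath : ∀ π : ℕ → V, (∀ n, E (π n) (π (n + 1))) → A.AcceptsSeq fun n => (lab (π n)).state)
    (v₀ : V) : A.Win t (lab v₀) := by
  classical
  have hrun : ∀ C : {C // A.Win t C}, ∃ r, A.AcceptingFrom t C.1 r := fun C => C.2
  choose run hrun using hrun
  let M := Σ C : {C // A.Win t C}, {v // v ∈ (run C).nodes}
  let lab' : V ⊕ M → Config Q := Sum.elim lab fun m => (run m.1).label m.2.1
  let E' : V ⊕ M → V ⊕ M → Prop := fun a b =>
    match a, b with
    | Sum.inl v, Sum.inl v' => E v v'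
    | Sum.inl _, Sum.inr _ => True
    | Sum.inr _, Sum.inl _ => False
    | Sum.inr m, Sum.inr m' => ∃ h : m.1 = m'.1, m'.2.1 ∈ (run m'.1).children (h ▸ m.2).1
  refine A.win_of_graph_aux t lab' E' ?_ ?_ (Sum.inl v₀)
  · rintro (v | ⟨C, v, hv⟩)
    · obtain ⟨L, hL, h⟩ := hstep v
      refine ⟨L, hL, fun c hc => ?_⟩
      rcases h c hc with hw | ⟨v', h1, h2⟩
      · exact ⟨Sum.inr ⟨⟨c, hw⟩, [], (run _).root_mem⟩, trivial, (hrun ⟨c, hw⟩).start⟩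
      · exact ⟨Sum.inl v', h1, h2⟩
    · refine ⟨_, (hrun C).good hv, ?_⟩
      rintro c ⟨v', hv', rfl⟩
      exact ⟨Sum.inr ⟨C, v', hv'.1⟩, ⟨rfl, hv'⟩, rfl⟩
  · intro π hπ
    by_cases hl : ∃ N m, π N = Sum.inr m
    · obtain ⟨N, m, hm⟩ := hl
      have : ∀ n, ∃ v : {v // v ∈ (run m.1).nodes}, π (n + N) = Sum.inr ⟨m.1, v⟩ := by
        intro n
        induction n with
        | zero => exact ⟨m.2, by simpa using hm⟩
        | succ n ih =>
          obtain ⟨v, hv⟩ := ih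
          have h := hπ (n + N)
          rw [hv] at h
          rcases h' : π (n + N + 1) with w | ⟨C, w⟩
          · rw [h'] at h; exact h.elim
          · rw [h'] at h
            obtain ⟨h1, -⟩ := h
            dsimp only at h1
            subst h1
            exact ⟨w, by rw [add_right_comm, h']⟩
      choose v hv using this
      rw [← A.acceptsSeq_add_iff _ N]
      have := (hrun m.1).path_from (v 0).1 (fun n => (v n).1) rfl (fun n => by
        have h := hπ (n + N)
        rw [show n + N + 1 = n + 1 + N by omega, hv, hv] at h
        exact h.2)
      simp only [hv]
      exact this
    · have : ∀ n, ∃ v, π n = Sum.inl v := by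
        intro n
        rcases h : π n with v | m
        · exact ⟨v, rfl⟩
        · exact (hl ⟨n, m, h⟩).elim
      choose v hv using this
      have := hpath v fun n => by
        have h := hπ n
        rw [hv, hv] at h
        exact h
      simp only [hv]
      exact this

theorem WinStep.win [Countable Q] {A : SymWPHAA k Q S} {t : LTree S} {C : Config Q}
    {L : Set (Config Q)} (h : A.WinStep t C L) : A.Win t C :=
  A.win_of_graph t (fun _ : Unit => C) (fun _ _ => False)
    (fun _ => ⟨L, h.1, fun c hc => Or.inl (h.2 c hc)⟩) (fun _ hπ => (hπ 0).elim) ()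

/-- All configurations in an accepting run are winning. -/
theorem AcceptingFrom.win_label [Countable Q] {A : SymWPHAA k Q S} {t : LTree S} {C : Config Q}
    {r : LTree (Config Q)} (h : A.AcceptingFrom t C r) {v : Node} (hv : v ∈ r.nodes) :
    A.Win t (r.label v) :=
  A.win_of_graph t (fun v : {v // v ∈ r.nodes} => r.label v.1)
    (fun v v' => v'.1 ∈ r.children v.1)
    (fun v => ⟨_, h.good v.2, by
      rintro c ⟨v', hv', rfl⟩
      exact Or.inr ⟨⟨v', hv'.1⟩, hv', rfl⟩⟩)
    (fun π hπ => h.path_from _ (fun n => (π n).1) rfl hπ) ⟨v, hv⟩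

theorem AcceptingFrom.winStep [Countable Q] {A : SymWPHAA k Q S} {t : LTree S} {C : Config Q}
    {r : LTree (Config Q)} (h : A.AcceptingFrom t C r) {v : Node} (hv : v ∈ r.nodes) :
    A.WinStep t (r.label v) (r.label '' r.children v) :=
  ⟨h.good hv, by rintro _ ⟨v', hv', rfl⟩; exact h.win_label hv'.1⟩

end SymWPHAA

/-! ### Progress inside existential parts -/

namespace PBF

variable {X : Type*}

theorem Sat.mono {Y Y' : Set X} (hY : Y ⊆ Y') {α : PBF X} (h : α.Sat Y) : α.Sat Y' := by
  induction α with
  | tt => trivial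
  | ff => exact h
  | var a => exact hY h
  | and α β ihα ihβ => exact ⟨ihα h.1, ihβ h.2⟩
  | or α β ihα ihβ => exact h.imp ihα ihβ

/-- Elements that are only disjunctively related are never needed together. -/
theorem DisjRelated.exists_subsingleton {P Y : Set X} {α : PBF X} (hα : α.DisjRelated P)
    (h : α.Sat Y) : ∃ Y' ⊆ Y ∩ α.atoms, α.Sat Y' ∧ (Y' ∩ P).Subsingleton := by
  induction α with
  | tt => exact ⟨∅, Set.empty_subset _, trivial, by simp⟩
  | ff => exact h.elim
  | var a => exact ⟨{a}, Set.singleton_subset_iff.2 ⟨h, rfl⟩, rfl,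
      Set.subsingleton_singleton.anti Set.inter_subset_left⟩
  | and α β ihα ihβ =>
    obtain ⟨Y₁, hY₁, hs₁, hp₁⟩ := ihα hα.1 h.1
    obtain ⟨Y₂, hY₂, hs₂, hp₂⟩ := ihβ hα.2.1 h.2
    refine ⟨Y₁ ∪ Y₂, ?_, ⟨hs₁.mono Set.subset_union_left, hs₂.mono Set.subset_union_right⟩, ?_⟩
    · rintro a (ha | ha)
      · exact ⟨(hY₁ ha).1, Or.inl (hY₁ ha).2⟩
      · exact ⟨(hY₂ ha).1, Or.inr (hY₂ ha).2⟩
    · rintro a ⟨ha | ha, haP⟩ b ⟨hb | hb, hbP⟩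
      · exact hp₁ ⟨ha, haP⟩ ⟨hb, hbP⟩
      · exact hα.2.2 a ⟨(hY₁ ha).2, haP⟩ b ⟨(hY₂ hb).2, hbP⟩
      · exact (hα.2.2 b ⟨(hY₁ hb).2, hbP⟩ a ⟨(hY₂ ha).2, haP⟩).symm
      · exact hp₂ ⟨ha, haP⟩ ⟨hb, hbP⟩
  | or α β ihα ihβ =>
    rcases h with h | h
    · obtain ⟨Y₁, hY₁, hs₁, hp₁⟩ := ihα hα.1 h
      exact ⟨Y₁, fun a ha => ⟨(hY₁ ha).1, Or.inl (hY₁ ha).2⟩, Or.inl hs₁, hp₁⟩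
    · obtain ⟨Y₂, hY₂, hs₂, hp₂⟩ := ihβ hα.2 h
      exact ⟨Y₂, fun a ha => ⟨(hY₂ ha).1, Or.inr (hY₂ ha).2⟩, Or.inr hs₂, hp₂⟩

end PBF

theorem SymWPAA.Step.state_mem {k : ℕ} {Q S : Type*} {A : SymWPAA k Q S} {t : LTree S}
    {C : Config Q} {L : Set (Config Q)} (h : A.Step t C L) {c : Config Q} (hc : c ∈ L) :
    c.state ∈ (A.transAt t C).states := by
  unfold SymWPAA.Step at h
  split at h
  · next p hp =>
    obtain ⟨-, rfl⟩ := h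
    rw [Set.mem_singleton_iff.1 hc, hp]
    exact Set.mem_singleton _
  · next p hp =>
    obtain ⟨-, rfl⟩ := h
    rw [Set.mem_singleton_iff.1 hc, hp]
    exact Set.mem_singleton _
  · next α hα =>
    obtain ⟨Y, hY, -, -, -, hL⟩ := h
    obtain ⟨d, p, hdp, z, -, rfl⟩ := hL c hc
    rw [hα]
    exact ⟨d, hY hdp⟩

namespace SymWPHAA

variable {k : ℕ} {Q S : Type*}

/-- A step from an existential part can be thinned out so that at most one of its configurations
stays in the part. -/
theorem Good.exists_thin {A : SymWPHAA k Q S} {t : LTree S} {C : Config Q} {L : Set (Config Q)}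
    (h : A.Good t C L) (hk : A.kind (A.part C.state) = Kind.existential) :
    ∃ L' ⊆ L, A.Good t C L' ∧ ∀ c ∈ L', ∀ c' ∈ L', A.part c.state = A.part C.state →
      A.part c'.state = A.part C.state → c = c' := by
  obtain ⟨hs, h0⟩ := h
  have hs' := hs
  unfold SymWPAA.Step at hs
  split at hs
  · obtain ⟨-, rfl⟩ := hs
    exact ⟨_, subset_rfl, ⟨hs', h0⟩, fun c hc c' hc' _ _ => hc.trans hc'.symm⟩
  · obtain ⟨-, rfl⟩ := hs
    exact ⟨_, subset_rfl, ⟨hs', h0⟩, fun c hc c' hc' _ _ => hc.trans hc'.symm⟩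
  · next α hα =>
    obtain ⟨Y, hY, hsat, hone, hbox, hL⟩ := hs
    let P : Set (Dir × Q) := {a | A.part a.2 = A.part C.state}
    by_cases hYP : (Y ∩ P).Nonempty
    · -- One tuple of the part is always kept, since dropping all of them might end the run at a
      -- configuration without children where `true` does not apply.
      obtain ⟨Y₀, hY₀, hsat₀, hsub⟩ :=
        (A.existential_disj _ _ _ α hk hα).exists_subsingleton hsat
      obtain ⟨a, haY, haP, ha⟩ : ∃ a ∈ Y, a ∈ P ∧ Y₀ ∩ P ⊆ {a} := by
        rcases (Y₀ ∩ P).eq_empty_or_nonempty with he | ⟨a, ha⟩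
        · obtain ⟨a, haY, haP⟩ := hYP
          exact ⟨a, haY, haP, by rw [he]; exact Set.empty_subset _⟩
        · exact ⟨a, (hY₀ ha.1).1, ha.2, fun b hb => hsub hb ha⟩
      obtain ⟨d, p⟩ := a
      have hd : d ≠ Dir.box := by
        rintro rfl
        exact A.existential_no_box _ _ _ α p hk hα haP (hY haY)
      obtain ⟨z₀, hz₀, hz₀L⟩ := hone d p haY hd
      refine ⟨{c ∈ L | A.part c.state ≠ A.part C.state} ∪ {⟨p, z₀, C.pebbles⟩}, ?_, ⟨?_, ?_⟩, ?_⟩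
      · rintro c (hc | rfl)
        · exact hc.1
        · exact hz₀L
      · unfold SymWPAA.Step
        rw [hα]
        refine ⟨(Y \ P) ∪ {(d, p)}, ?_, hsat₀.mono ?_, ?_, ?_, ?_⟩
        · rintro b (hb | rfl)
          · exact hY hb.1
          · exact hY haY
        · intro b hb
          by_cases hbP : b ∈ P
          · exact Or.inr (ha ⟨hb, hbP⟩)
          · exact Or.inl ⟨(hY₀ hb).1, hbP⟩
        · rintro d' p' (hb | hb) hd'
          · obtain ⟨z, hz, hzL⟩ := hone d' p' hb.1 hd'
            exact ⟨z, hz, Or.inl ⟨hzL, hb.2⟩⟩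
          · obtain ⟨rfl, rfl⟩ := Prod.ext_iff.1 hb
            exact ⟨z₀, hz₀, Or.inr rfl⟩
        · rintro p' (hb | hb) z hz
          · exact Or.inl ⟨hbox p' hb.1 z hz, hb.2⟩
          · exact (hd (congrArg Prod.fst hb).symm).elim
        · rintro c (⟨hcL, hc⟩ | rfl)
          · obtain ⟨d', p', hdp, z, hz, rfl⟩ := hL c hcL
            exact ⟨d', p', Or.inl ⟨hdp, hc⟩, z, hz, rfl⟩
          · exact ⟨d, p, Or.inr rfl, z₀, hz₀, rfl⟩
      · intro he
        exact absurd (he ▸ Or.inr rfl : (⟨p, z₀, C.pebbles⟩ : Config Q) ∈ (∅ : Set (Config Q)))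
          (Set.notMem_empty _)
      · rintro c (hc | rfl) c' (hc' | rfl) h1 h2
        · exact (hc.2 h1).elim
        · exact (hc.2 h1).elim
        · exact (hc'.2 h2).elim
        · rfl
    · refine ⟨L, subset_rfl, ⟨hs', h0⟩, fun c hc _ _ h1 _ => ?_⟩
      obtain ⟨d, p, hdp, z, -, rfl⟩ := hL c hc
      exact (hYP ⟨_, hdp, h1⟩).elim

/-- The successor `c` of `C` is the only one in the part of `C`, for some winning step. -/
def Follows (A : SymWPHAA k Q S) (t : LTree S) (C c : Config Q) : Prop :=
  A.part c.state = A.part C.state ∧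
    ∃ L, A.WinStep t C L ∧ c ∈ L ∧ ∀ c' ∈ L, A.part c'.state = A.part C.state → c = c'

/-- Some winning step from `C` leaves the part of `C` or visits `G`. -/
def Succeeds (A : SymWPHAA k Q S) (t : LTree S) (C : Config Q) : Prop :=
  ∃ L, A.WinStep t C L ∧ ∀ c ∈ L, A.part c.state = A.part C.state → c.state ∈ A.G

/-- From `C`, a path of `n` steps inside the part of `C`, each to the only successor in the part,
leads to a configuration from which the next step visits `G` or leaves the part. -/
def SucceedsIn (A : SymWPHAA k Q S) (t : LTree S) : ℕ → Config Q → Prop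
  | 0, C => A.Succeeds t C
  | n + 1, C => ∃ c, A.Follows t C c ∧ A.SucceedsIn t n c

theorem SucceedsIn.exists_step {A : SymWPHAA k Q S} {t : LTree S} {n : ℕ} {C : Config Q}
    (h : A.SucceedsIn t n C) :
    ∃ L, A.WinStep t C L ∧ ∀ c ∈ L, A.part c.state = A.part C.state →
      c.state ∈ A.G ∨ ∃ m < n, A.SucceedsIn t m c := by
  cases n with
  | zero =>
    obtain ⟨L, hL, h⟩ := h
    exact ⟨L, hL, fun c hc hp => Or.inl (h c hc hp)⟩
  | succ n =>
    obtain ⟨c, ⟨-, L, hL, -, hu⟩, hn⟩ := h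
    exact ⟨L, hL, fun c' hc' hp => Or.inr ⟨n, n.lt_succ_self, hu c' hc' hp ▸ hn⟩⟩

theorem SucceedsIn.win [Countable Q] {A : SymWPHAA k Q S} {t : LTree S} {n : ℕ} {C : Config Q}
    (h : A.SucceedsIn t n C) : A.Win t C :=
  let ⟨_, hL, _⟩ := h.exists_step
  hL.win

/-- Otherwise an infinite path of the run would stay in the existential part and avoid `G`. -/
theorem Win.exists_succeedsIn [Countable Q] {A : SymWPHAA k Q S} {t : LTree S} {C : Config Q}
    (h : A.Win t C) (hk : A.kind (A.part C.state) = Kind.existential) :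
    ∃ n, A.SucceedsIn t n C := by
  obtain ⟨r, hr⟩ := h
  by_contra! hC
  let J : Node → Prop := fun v => v ∈ r.nodes ∧ A.part (r.label v).state = A.part C.state ∧
    ∀ n, ¬A.SucceedsIn t n (r.label v)
  have hnext : ∀ v : {v // J v}, ∃ v' : {v // J v}, v'.1 ∈ r.children v.1 ∧
      (r.label v'.1).state ∉ A.G := by
    rintro ⟨v, hv, hp, hn⟩
    obtain ⟨L, hLsub, hL, hu⟩ := (hr.good hv).exists_thin (by rw [hp]; exact hk)
    have hw : A.WinStep t (r.label v) L := ⟨hL, fun c hc => (hr.winStep hv).2 c (hLsub hc)⟩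
    have hns : ¬A.Succeeds t (r.label v) := hn 0
    simp only [Succeeds, not_exists, not_and, not_forall] at hns
    obtain ⟨c, hc, hcp, hcG⟩ := hns L hw
    obtain ⟨v', hv', rfl⟩ := hLsub hc
    exact ⟨⟨v', hv'.1, hcp.trans hp, fun n hn' =>
      hn (n + 1) ⟨_, ⟨hcp, L, hw, hc, fun c' hc' hp' => hu _ hc _ hc' hcp hp'⟩, hn'⟩⟩, hv', hcG⟩
  choose next hnext hG using hnext
  let π : ℕ → {v // J v} := fun n =>
    Nat.rec ⟨[], r.root_mem, by rw [hr.start], by rw [hr.start]; exact hC⟩ (fun _ v => next v) n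
  obtain ⟨i, ⟨N, hN⟩, hacc⟩ := hr.path_from _ (fun n => (π n).1) rfl fun n => hnext (π n)
  have hi : A.part C.state = i := (π N).2.2.1.symm.trans (hN N le_rfl)
  rw [hi] at hk
  rcases hacc with ⟨-, q, hq, hqG⟩ | ⟨hk', -⟩
  · obtain ⟨n, hn, rfl⟩ := hq 1
    obtain ⟨n, rfl⟩ := Nat.exists_eq_add_of_le' hn
    exact hG (π n) hqG
  · rw [hk] at hk'
    cases hk'

end SymWPHAA

/-! ### Locality: behaviour inside the subtree of a child -/

section Config

variable {Q S : Type*}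

/-- The configuration `C` with the pebbles `ys` placed before those of `C`. -/
def Config.withBelow (ys : List Node) (C : Config Q) : Config Q :=
  ⟨C.state, C.pos, C.pebbles ++ ys⟩

theorem Config.withBelow_injective (ys : List Node) :
    Function.Injective (Config.withBelow ys : Config Q → Config Q) := by
  rintro ⟨q, z, l⟩ ⟨q', z', l'⟩ h
  simpa [Config.withBelow] using h

/-- The position and the pebbles of `C` lie in the subtree of `u`, and each pebble lies in the
subtree of the previous one, the position in that of the last one.  For `u = []` this is what holds
for all configurations of a run. -/
def Inside (u : Node) (C : Config Q) : Prop :=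
  u <:+ C.pos ∧ List.IsChain (fun a b => b <:+ a) (C.pos :: C.pebbles) ∧ ∀ y ∈ C.pebbles, u <:+ y

/-- The last placed pebble is not below the level of `x`. -/
def Low (x : Node) (ys : List Node) : Prop :=
  ∀ y ∈ ys.head?, y.length ≤ x.length

/-- The configurations that occur when a run moves in the subtree of the child `a :: x` up to the
moment when it returns to `x`.  Since a run cannot go up from its last pebble, it returns without
pebbles in the subtree. -/
def InsideOrExit (a : ℕ) (x : Node) (C : Config Q) : Prop :=
  Inside (a :: x) C ∨ ∃ p, C = ⟨p, x, []⟩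

theorem inside_child (a : ℕ) (x : Node) (p : Q) : Inside (a :: x) (⟨p, a :: x, []⟩ : Config Q) :=
  ⟨List.suffix_rfl, List.isChain_singleton _, by simp⟩

theorem Inside.low {u : Node} {C : Config Q} (h : Inside u C) : Low C.pos C.pebbles := by
  obtain ⟨q, x, l⟩ := C
  cases l with
  | nil => simp [Low]
  | cons y l =>
    intro z hz
    obtain rfl : y = z := by simpa using hz
    exact (List.isChain_cons_cons.1 h.2.1).1.length_le

theorem Inside.drop {u : Node} {C : Config Q} (h : Inside u C) (p : Q) :
    Inside u (⟨p, C.pos, C.pos :: C.pebbles⟩ : Config Q) :=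
  ⟨h.1, List.isChain_cons_cons.2 ⟨List.suffix_rfl, h.2.1⟩, List.forall_mem_cons.2 ⟨h.1, h.2.2⟩⟩

theorem Inside.lift {u : Node} {C : Config Q} (h : Inside u C)
    (hp : C.pebbles.head? = some C.pos) (p : Q) :
    Inside u (⟨p, C.pos, C.pebbles.tail⟩ : Config Q) := by
  obtain ⟨q, x, l⟩ := C
  cases l with
  | nil => simp at hp
  | cons y l =>
    obtain rfl : y = x := by simpa using hp
    exact ⟨h.1, (List.isChain_cons_cons.1 h.2.1).2, (List.forall_mem_cons.1 h.2.2).2⟩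

theorem Inside.move {u : Node} {C : Config Q} (h : Inside u C) (t : LTree S) {d : Dir}
    {z : Node} (hz : z ∈ targets t C.pos d) (hd : d = Dir.up → C.onPebble = false) (p : Q) :
    Inside u (⟨p, z, C.pebbles⟩ : Config Q) ∨ ∃ a, u = a :: z ∧ C.pebbles = [] := by
  obtain ⟨q, x, l⟩ := C
  obtain ⟨hx, hc, hl⟩ := h
  dsimp only at hx hc hl hz
  have hdown : ∀ c, Inside u (⟨p, c :: x, l⟩ : Config Q) := fun c =>
    ⟨hx.trans (List.suffix_cons c x), by
      cases l with
      | nil => exact List.isChain_singleton _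
      | cons y l =>
        rw [List.isChain_cons_cons] at hc ⊢
        exact ⟨hc.1.trans (List.suffix_cons c x), hc.2⟩, hl⟩
  cases d with
  | box => obtain ⟨-, c, rfl⟩ := hz; exact Or.inl (hdown c)
  | dia => obtain ⟨-, c, rfl⟩ := hz; exact Or.inl (hdown c)
  | stay => obtain rfl := hz; exact Or.inl ⟨hx, hc, hl⟩
  | root => obtain ⟨rfl, -⟩ := hz; exact Or.inl ⟨hx, hc, hl⟩
  | up =>
    obtain ⟨c, rfl⟩ := hz
    have hon := hd rfl
    cases l with
    | nil =>
      rcases List.suffix_cons_iff.1 hx with rfl | hx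
      · exact Or.inr ⟨c, rfl, rfl⟩
      · exact Or.inl ⟨hx, List.isChain_singleton _, by simp⟩
    | cons y l =>
      rw [List.isChain_cons_cons] at hc
      rcases List.suffix_cons_iff.1 hc.1 with rfl | hy
      · simp [Config.onPebble] at hon
      · exact Or.inl ⟨(hl y (by simp)).trans hy, List.isChain_cons_cons.2 ⟨hy, hc.2⟩, hl⟩

theorem Inside.onPebble_withBelow {a : ℕ} {x : Node} {C : Config Q} (h : Inside (a :: x) C)
    {ys : List Node} (hys : Low x ys) : (C.withBelow ys).onPebble = C.onPebble := by
  obtain ⟨q, z, l⟩ := C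
  cases l with
  | nil =>
    have : ys.head? ≠ some z := fun h0 => by
      have h1 := hys z h0
      have h2 := h.1.length_le
      simp only [List.length_cons] at h2
      omega
    simp [Config.onPebble, Config.withBelow, this]
  | cons y l => simp [Config.onPebble, Config.withBelow]

end Config

namespace SymWPAA

variable {k : ℕ} {Q S : Type*}

theorem Step.length_le {A : SymWPAA k Q S} {t : LTree S} {C : Config Q} {L : Set (Config Q)}
    (h : A.Step t C L) (hC : C.pebbles.length ≤ k) {c : Config Q} (hc : c ∈ L) :
    c.pebbles.length ≤ k := by
  unfold Step at h
  split at h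
  · obtain ⟨h, rfl⟩ := h
    rw [Set.mem_singleton_iff.1 hc]
    exact h
  · obtain ⟨h, rfl⟩ := h
    rw [Set.mem_singleton_iff.1 hc]
    simp only [List.length_tail]
    omega
  · obtain ⟨Y, -, -, -, -, hL⟩ := h
    obtain ⟨d, p, -, z, -, rfl⟩ := hL c hc
    exact hC

/-- A tuple with direction `-1` occurs only where the last pebble does not lie. -/
theorem onPebble_of_up_mem (A : SymWPAA k Q S) {t : LTree S} {C : Config Q} {α : PBF (Dir × Q)}
    (hα : A.transAt t C = Trans.form α) {d : Dir} {p : Q} (h : (d, p) ∈ α.atoms)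
    (hd : d = Dir.up) : C.onPebble = false := by
  subst hd
  by_contra hb
  rw [Bool.not_eq_false] at hb
  unfold transAt at hα
  rw [hb] at hα
  exact A.no_up _ _ _ _ hα h

end SymWPAA

namespace SymWPHAA

variable {k : ℕ} {Q S : Type*}

/-- Inside the subtree of a child of `x`, a step does not depend on where the pebbles outside of the
subtree are placed. -/
theorem Good.local {A : SymWPHAA k Q S} {t : LTree S} {a : ℕ} {x : Node} {C : Config Q}
    (hC : Inside (a :: x) C) {ys ys' : List Node} (hlow : Low x ys) (hlow' : Low x ys')
    (hlen : ys.length = ys'.length) {L : Set (Config Q)} (h : A.Good t (C.withBelow ys) L) :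
    A.Good t (C.withBelow ys')
      (Config.withBelow ys' '' {c | c.withBelow ys ∈ L ∧ InsideOrExit a x c}) ∧
      ∀ c ∈ L, ∃ c', InsideOrExit a x c' ∧ c = c'.withBelow ys := by
  have htr : ∀ {zs}, Low x zs → A.transAt t (C.withBelow zs) = A.transAt t C := fun hz => by
    unfold SymWPAA.transAt
    rw [hC.onPebble_withBelow hz]
    rfl
  obtain ⟨hs, h0⟩ := h
  have hall : ∀ c ∈ L, ∃ c', InsideOrExit a x c' ∧ c = c'.withBelow ys := by
    intro c hc
    unfold SymWPAA.Step at hs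
    split at hs
    · next p hp =>
      obtain ⟨-, rfl⟩ := hs
      rw [Set.mem_singleton_iff.1 hc]
      exact ⟨⟨p, C.pos, C.pos :: C.pebbles⟩, Or.inl (hC.drop p), rfl⟩
    · next p hp =>
      obtain ⟨hhead, rfl⟩ := hs
      rw [Set.mem_singleton_iff.1 hc]
      have hon : C.onPebble = true := by
        rw [← hC.onPebble_withBelow hlow]
        exact decide_eq_true hhead
      have hhead' : C.pebbles.head? = some C.pos := of_decide_eq_true hon
      refine ⟨⟨p, C.pos, C.pebbles.tail⟩, Or.inl (hC.lift hhead' p), ?_⟩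
      have hne : C.pebbles ≠ [] := by rintro h0; simp [h0] at hhead'
      simp [Config.withBelow, List.tail_append_of_ne_nil hne]
    · next α hα =>
      obtain ⟨Y, hY, -, -, -, hL⟩ := hs
      obtain ⟨d, p, hdp, z, hz, rfl⟩ := hL c hc
      refine ⟨⟨p, z, C.pebbles⟩, ?_, rfl⟩
      rcases hC.move t hz (SymWPAA.onPebble_of_up_mem _ ((htr hlow).symm.trans hα) (hY hdp)) p
        with h | ⟨b, h1, h2⟩
      · exact Or.inl h
      · obtain ⟨rfl, rfl⟩ := List.cons.inj h1
        exact Or.inr ⟨p, by rw [h2]⟩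
  have hback : ∀ {p z l}, (⟨p, z, l ++ ys⟩ : Config Q) ∈ L → (⟨p, z, l ++ ys'⟩ : Config Q) ∈
      Config.withBelow ys' '' {c | c.withBelow ys ∈ L ∧ InsideOrExit a x c} := by
    intro p z l hm
    obtain ⟨c', hc', he⟩ := hall _ hm
    obtain rfl : (⟨p, z, l⟩ : Config Q) = c' := Config.withBelow_injective ys he
    exact ⟨⟨p, z, l⟩, ⟨hm, hc'⟩, rfl⟩
  have hsub : ∀ {c : Config Q}, L = {c.withBelow ys} →
      Config.withBelow ys' '' {c | c.withBelow ys ∈ L ∧ InsideOrExit a x c} =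
        {c.withBelow ys'} := by
    rintro c rfl
    obtain ⟨c', hc', he⟩ := hall _ rfl
    obtain rfl := Config.withBelow_injective ys he
    ext D
    constructor
    · rintro ⟨c'', ⟨h1, -⟩, rfl⟩
      rw [Config.withBelow_injective ys h1]
      rfl
    · rintro rfl
      exact ⟨c, ⟨rfl, hc'⟩, rfl⟩
  refine ⟨⟨?_, ?_⟩, hall⟩
  · unfold SymWPAA.Step at hs ⊢
    rw [htr hlow] at hs
    rw [htr hlow']
    split at hs
    · next p hp =>
      obtain ⟨hk, hL⟩ := hs
      refine ⟨?_, hsub (c := ⟨p, C.pos, C.pos :: C.pebbles⟩) hL⟩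
      simpa [Config.withBelow, hlen] using hk
    · next p hp =>
      obtain ⟨hhead, hL⟩ := hs
      have hon : C.onPebble = true := by
        rw [← hC.onPebble_withBelow hlow]
        exact decide_eq_true hhead
      have hhead' : C.pebbles.head? = some C.pos := of_decide_eq_true hon
      have hne : C.pebbles ≠ [] := by rintro h0; simp [h0] at hhead'
      refine ⟨?_, ?_⟩
      · rw [← hC.onPebble_withBelow hlow'] at hon
        exact of_decide_eq_true hon
      · rw [hsub (c := ⟨p, C.pos, C.pebbles.tail⟩)]
        · simp [Config.withBelow, List.tail_append_of_ne_nil hne]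
        · rw [hL]
          simp [Config.withBelow, List.tail_append_of_ne_nil hne]
    · next α hα =>
      obtain ⟨Y, hY, hsat, hone, hbox, hL⟩ := hs
      refine ⟨Y, hY, hsat, fun d p hdp hd => ?_, fun p hp z hz => hback (hbox p hp z hz), ?_⟩
      · obtain ⟨z, hz, hzL⟩ := hone d p hdp hd
        exact ⟨z, hz, hback hzL⟩
      · rintro _ ⟨c, ⟨hc, -⟩, rfl⟩
        obtain ⟨d, p, hdp, z, hz, he⟩ := hL _ hc
        obtain rfl : c = ⟨p, z, C.pebbles⟩ := Config.withBelow_injective ys he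
        exact ⟨d, p, hdp, z, hz, rfl⟩
  · intro he
    obtain ⟨α, hα, h⟩ := h0 (by
      rw [Set.eq_empty_iff_forall_notMem]
      intro c hc
      obtain ⟨c', hc', rfl⟩ := hall c hc
      exact absurd (he ▸ Set.mem_image_of_mem _ ⟨hc, hc'⟩) (Set.notMem_empty (c'.withBelow ys')))
    exact ⟨α, by rw [htr hlow', ← htr hlow, hα], h⟩

/-- Two placements of pebbles, none in the subtree of a child of `x`, that are indistinguishable
inside these subtrees: they have the same number of pebbles, and a return to `x` that is winning
for `ys` is winning for `ys'`. -/
structure Alike (A : SymWPHAA k Q S) (t : LTree S) (x : Node) (ys ys' : List Node) : Prop where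
  low : Low x ys
  low' : Low x ys'
  length_eq : ys.length = ys'.length
  win : ∀ p, A.Win t ⟨p, x, ys⟩ → A.Win t ⟨p, x, ys'⟩

theorem Win.local [Countable Q] {A : SymWPHAA k Q S} {t : LTree S} {a : ℕ} {x : Node}
    {ys ys' : List Node} (h : A.Alike t x ys ys') {C : Config Q} (hC : InsideOrExit a x C)
    (hw : A.Win t (C.withBelow ys)) : A.Win t (C.withBelow ys') := by
  rcases hC with hC | ⟨p, rfl⟩
  · obtain ⟨r, hr⟩ := hw
    refine A.win_of_graph t
      (V := {m : Node × Config Q //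
        m.1 ∈ r.nodes ∧ r.label m.1 = m.2.withBelow ys ∧ Inside (a :: x) m.2})
      (fun m => m.1.2.withBelow ys') (fun m m' => m'.1.1 ∈ r.children m.1.1) ?_ ?_
      ⟨([], C), r.root_mem, hr.start, hC⟩
    · rintro ⟨⟨v, c⟩, hv, hvc, hc⟩
      have hg := hr.good hv
      rw [hvc] at hg
      refine ⟨_, (hg.local hc h.low h.low' h.length_eq).1, ?_⟩
      rintro _ ⟨c', ⟨⟨v', hv', he⟩, hc' | ⟨p, rfl⟩⟩, rfl⟩
      · exact Or.inr ⟨⟨(v', c'), hv'.1, he, hc'⟩, hv', rfl⟩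
      · refine Or.inl (h.win p ?_)
        have := hr.win_label hv'.1
        rwa [he] at this
    · intro π hπ
      have := hr.path_from _ (fun n => (π n).1.1) rfl hπ
      have hst : ∀ n, (r.label (π n).1.1).state = (π n).1.2.state := fun n => by
        rw [(π n).2.2.1]; rfl
      simp only [hst] at this
      exact this
  · exact h.win p hw

theorem WinStep.local [Countable Q] {A : SymWPHAA k Q S} {t : LTree S} {a : ℕ} {x : Node}
    {ys ys' : List Node} (h : A.Alike t x ys ys') {C : Config Q} (hC : Inside (a :: x) C)
    {L : Set (Config Q)} (hL : A.WinStep t (C.withBelow ys) L) :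
    A.WinStep t (C.withBelow ys')
      (Config.withBelow ys' '' {c | c.withBelow ys ∈ L ∧ InsideOrExit a x c}) := by
  refine ⟨(hL.1.local hC h.low h.low' h.length_eq).1, ?_⟩
  rintro _ ⟨c, ⟨hc, hc'⟩, rfl⟩
  exact Win.local h hc' (hL.2 _ hc)

theorem Succeeds.local [Countable Q] {A : SymWPHAA k Q S} {t : LTree S} {a : ℕ} {x : Node}
    {ys ys' : List Node} (h : A.Alike t x ys ys') {C : Config Q} (hC : Inside (a :: x) C)
    (hs : A.Succeeds t (C.withBelow ys)) : A.Succeeds t (C.withBelow ys') := by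
  obtain ⟨L, hL, hG⟩ := hs
  refine ⟨_, hL.local h hC, ?_⟩
  rintro _ ⟨c, ⟨hc, -⟩, rfl⟩ hp
  exact hG (c.withBelow ys) hc hp

theorem Follows.insideOrExit {A : SymWPHAA k Q S} {t : LTree S} {a : ℕ} {x : Node}
    {ys : List Node} (h : Low x ys) {C c : Config Q} (hC : Inside (a :: x) C)
    (hf : A.Follows t (C.withBelow ys) c) : ∃ c', InsideOrExit a x c' ∧ c = c'.withBelow ys := by
  obtain ⟨-, L, hL, hc, -⟩ := hf
  exact (hL.1.local hC h h rfl).2 c hc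

theorem Follows.local [Countable Q] {A : SymWPHAA k Q S} {t : LTree S} {a : ℕ} {x : Node}
    {ys ys' : List Node} (h : A.Alike t x ys ys') {C c : Config Q} (hC : Inside (a :: x) C)
    (hf : A.Follows t (C.withBelow ys) (c.withBelow ys)) :
    A.Follows t (C.withBelow ys') (c.withBelow ys') := by
  obtain ⟨c', hc', he⟩ := hf.insideOrExit h.low hC
  obtain rfl := Config.withBelow_injective ys he
  obtain ⟨hp, L, hL, hc, hu⟩ := hf
  refine ⟨hp, _, hL.local h hC, ⟨c, ⟨hc, hc'⟩, rfl⟩, ?_⟩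
  rintro _ ⟨c'', ⟨hc'', -⟩, rfl⟩ hp'
  rw [Config.withBelow_injective ys (hu _ hc'' hp')]

/-- The two ways for a path to end its visit to the subtree of the child `a :: x`: it succeeds
inside the subtree (`none`), or it returns to `x` in the state `p` (`some p`). -/
def Ends (A : SymWPHAA k Q S) (t : LTree S) (a : ℕ) (x : Node) (ys : List Node) :
    Option Q → Config Q → Prop
  | none, C => Inside (a :: x) C ∧ A.Succeeds t (C.withBelow ys)
  | some p, C => C = ⟨p, x, []⟩

/-- The path from `C` can end its visit to the subtree of `a :: x` in the way `o` after `n` steps;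
the pebbles in the subtree are those of `C`, the pebbles outside are `ys`. -/
def EndsIn (A : SymWPHAA k Q S) (t : LTree S) (a : ℕ) (x : Node) (ys : List Node) (o : Option Q) :
    ℕ → Config Q → Prop
  | 0, C => A.Ends t a x ys o C
  | n + 1, C => Inside (a :: x) C ∧ ∃ c, A.Follows t (C.withBelow ys) (c.withBelow ys) ∧
      A.EndsIn t a x ys o n c

theorem EndsIn.local [Countable Q] {A : SymWPHAA k Q S} {t : LTree S} {a : ℕ} {x : Node}
    {ys ys' : List Node} (h : A.Alike t x ys ys') {o : Option Q} {n : ℕ} {C : Config Q}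
    (he : A.EndsIn t a x ys o n C) : A.EndsIn t a x ys' o n C := by
  induction n generalizing C with
  | zero =>
    cases o with
    | none => exact ⟨he.1, he.2.local h he.1⟩
    | some p => exact he
  | succ n ih =>
    obtain ⟨hC, c, hf, hn⟩ := he
    exact ⟨hC, c, hf.local h hC, ih hn⟩

/-- After a visit to a subtree that ends in the way `o`, success takes `n` further steps. -/
def ThenSucceedsIn (A : SymWPHAA k Q S) (t : LTree S) (x : Node) (ys : List Node) :
    Option Q → ℕ → Prop
  | none, n => n = 0
  | some p, n => A.SucceedsIn t n ⟨p, x, ys⟩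

theorem EndsIn.succeedsIn {A : SymWPHAA k Q S} {t : LTree S} {a : ℕ} {x : Node}
    {ys : List Node} {o : Option Q} {m n : ℕ} {C : Config Q} (h : A.EndsIn t a x ys o m C)
    (hn : A.ThenSucceedsIn t x ys o n) : A.SucceedsIn t (n + m) (C.withBelow ys) := by
  induction m generalizing C with
  | zero =>
    cases o with
    | none => cases hn; exact h.2
    | some p => cases h; exact hn
  | succ m ih =>
    obtain ⟨-, c, hf, hm⟩ := h
    exact ⟨_, hf, ih hm⟩

theorem SucceedsIn.exists_endsIn {A : SymWPHAA k Q S} {t : LTree S} {a : ℕ} {x : Node}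
    {ys : List Node} (hlow : Low x ys) {n : ℕ} {C : Config Q} (hC : InsideOrExit a x C)
    (h : A.SucceedsIn t n (C.withBelow ys)) :
    ∃ o l m, l + m = n ∧ A.EndsIn t a x ys o m C ∧ A.ThenSucceedsIn t x ys o l := by
  rcases hC with hC | ⟨p, rfl⟩
  · induction n generalizing C with
    | zero => exact ⟨none, 0, 0, rfl, ⟨hC, h⟩, rfl⟩
    | succ n ih =>
      obtain ⟨c, hf, hn⟩ := h
      obtain ⟨c, hc | ⟨p, rfl⟩, rfl⟩ := hf.insideOrExit hlow hC
      · obtain ⟨o, l, m, hlm, h1, h2⟩ := ih hn hc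
        exact ⟨o, l, m + 1, by omega, ⟨hC, c, hf, h1⟩, h2⟩
      · exact ⟨some p, n, 1, rfl, ⟨hC, _, hf, rfl⟩, hn⟩
  · exact ⟨some p, n, 0, rfl, rfl, h⟩

end SymWPHAA

/-! ### Choosing children -/

namespace SymWPHAA

variable {k : ℕ} {Q S : Type*}

/-- The child `a :: x` serves the purpose `o` for a move from `x` in state `p`, at the cost `n`.
For the purpose `none` the child has to be winning, and the cost is the number of steps it takes to
succeed inside its subtree, or infinite.  For the purpose `some p'` the cost is the number of steps
it takes to return to `x` in the state `p'`. -/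
def Serves (A : SymWPHAA k Q S) (t : LTree S) (x : Node) (ys : List Node) (p : Q) :
    Option Q → ℕ → ℕ∞ → Prop
  | none, a, n => A.Win t ⟨p, a :: x, ys⟩ ∧
      ∀ m : ℕ, n = m → A.EndsIn t a x ys none m ⟨p, a :: x, []⟩
  | some p', a, n => ∃ m : ℕ, n = m ∧ A.EndsIn t a x ys (some p') m ⟨p, a :: x, []⟩

theorem Serves.local [Countable Q] {A : SymWPHAA k Q S} {t : LTree S} {x : Node}
    {ys ys' : List Node} (h : A.Alike t x ys ys') {p : Q} {o : Option Q} {a : ℕ} {n : ℕ∞}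
    (hs : A.Serves t x ys p o a n) : A.Serves t x ys' p o a n := by
  cases o with
  | none => exact ⟨Win.local h (Or.inl (inside_child a x p)) hs.1, fun m hm => (hs.2 m hm).local h⟩
  | some p' =>
    obtain ⟨m, hm, he⟩ := hs
    exact ⟨m, hm, he.local h⟩

/-- What matters about a placement `ys` of pebbles inside the subtrees of the children of `x`: the
number of pebbles and the set `W` of states in which it is winning to be at `x`. -/
def HasProfile (A : SymWPHAA k Q S) (t : LTree S) (x : Node) (i : ℕ) (W : Finset Q)
    (ys : List Node) : Prop :=
  Low x ys ∧ ys.length = i ∧ ∀ p, p ∈ W ↔ A.Win t ⟨p, x, ys⟩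

theorem HasProfile.alike {A : SymWPHAA k Q S} {t : LTree S} {x : Node} {i : ℕ} {W : Finset Q}
    {ys ys' : List Node} (h : A.HasProfile t x i W ys) (h' : A.HasProfile t x i W ys') :
    A.Alike t x ys ys' :=
  ⟨h.1, h'.1, h.2.1.trans h'.2.1.symm, fun p hp => (h'.2.2 p).1 ((h.2.2 p).2 hp)⟩

/-- What a child is chosen for: the number of placed pebbles, the state in which the child is
entered, the set of winning states at its parent, and the purpose in the sense of `Serves`. -/
abbrev Task (Q : Type*) := ℕ × Q × (Σ _ : Finset Q, Option Q)

/-- Whenever some child of `x` serves for the given task at some cost, so does the child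
`a :: x`, at no higher cost. -/
def IsBest (A : SymWPHAA k Q S) (t : LTree S) (x : Node) (κ : Task Q) (a : ℕ) : Prop :=
  ∀ ys, A.HasProfile t x κ.1 κ.2.2.1 ys → ∀ b n, b :: x ∈ t.nodes →
    A.Serves t x ys κ.2.1 κ.2.2.2 b n → ∃ m ≤ n, A.Serves t x ys κ.2.1 κ.2.2.2 a m

theorem exists_isBest [Countable Q] (A : SymWPHAA k Q S) (t : LTree S) {x : Node}
    (hx : (t.children x).Nonempty) (κ : Task Q) : ∃ a, a :: x ∈ t.nodes ∧ A.IsBest t x κ a := by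
  let costs : Set ℕ∞ := {n | ∃ ys a, A.HasProfile t x κ.1 κ.2.2.1 ys ∧ a :: x ∈ t.nodes ∧
    A.Serves t x ys κ.2.1 κ.2.2.2 a n}
  by_cases hne : costs.Nonempty
  · obtain ⟨ys, a, hys, ha, hs⟩ := wellFounded_lt.min_mem costs hne
    refine ⟨a, ha, fun ys' hys' b n hb hs' => ?_⟩
    exact ⟨_, not_lt.1 (wellFounded_lt.not_lt_min costs ⟨ys', b, hys', hb, hs'⟩),
      hs.local (hys.alike hys')⟩
  · obtain ⟨_, hm, a, rfl⟩ := hx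
    exact ⟨a, hm, fun ys hys b n hb hs => (hne ⟨n, ys, b, hys, hb, hs⟩).elim⟩

/-- A move to the child `b :: x` may be redirected to the best child for a suitable task: the move
remains winning, and success takes at most as many steps as before. -/
theorem exists_redirect [Countable Q] (A : SymWPHAA k Q S) {t : LTree S} {x : Node} {i : ℕ}
    {W : Finset Q} {ys : List Node} (hys : A.HasProfile t x i W ys) {p : Q} {b : ℕ}
    (hb : b :: x ∈ t.nodes) (hw : A.Win t ⟨p, b :: x, ys⟩) (N : ℕ) :
    ∃ o : Option Q, (∀ p' ∈ o, p' ∈ W) ∧ ∀ a, A.IsBest t x (i, p, ⟨W, o⟩) a →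
      A.Win t ⟨p, a :: x, ys⟩ ∧ ((∃ n < N, A.SucceedsIn t n ⟨p, b :: x, ys⟩) →
        ∃ n < N, A.SucceedsIn t n ⟨p, a :: x, ys⟩) := by
  by_cases h : ∃ n < N, A.SucceedsIn t n ⟨p, b :: x, ys⟩
  · obtain ⟨n, hn, hs⟩ := h
    obtain ⟨o, l, m, hlm, he, hthen⟩ :=
      SucceedsIn.exists_endsIn (C := ⟨p, b :: x, []⟩) hys.1 (Or.inl (inside_child b x p)) hs
    suffices hsuff : (∀ p' ∈ o, p' ∈ W) ∧ ∀ a, A.IsBest t x (i, p, ⟨W, o⟩) a →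
        ∃ n < N, A.SucceedsIn t n ⟨p, a :: x, ys⟩ by
      refine ⟨o, hsuff.1, fun a ha => ?_⟩
      obtain ⟨n', hn', hs'⟩ := hsuff.2 a ha
      exact ⟨hs'.win, fun _ => ⟨n', hn', hs'⟩⟩
    cases o with
    | none =>
      refine ⟨by simp, fun a ha => ?_⟩
      obtain ⟨m', hm', -, he'⟩ := ha ys hys b m hb ⟨hw, fun m₁ hm₁ => by
        obtain rfl : m = m₁ := by exact_mod_cast hm₁
        exact he⟩
      lift m' to ℕ using ne_top_of_le_ne_top (ENat.natCast_ne_top m) hm'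
      have hle : m' ≤ m := by exact_mod_cast hm'
      exact ⟨l + m', by omega, (he' m' rfl).succeedsIn hthen⟩
    | some p' =>
      refine ⟨fun p₁ hp₁ => ?_, fun a ha => ?_⟩
      · obtain rfl : p' = p₁ := by simpa using hp₁
        exact (hys.2.2 _).2 (SucceedsIn.win hthen)
      · obtain ⟨_, hm', m', rfl, he'⟩ := ha ys hys b m hb ⟨m, rfl, he⟩
        have hle : m' ≤ m := by exact_mod_cast hm'
        exact ⟨l + m', by omega, he'.succeedsIn hthen⟩
  · refine ⟨none, by simp, fun a ha => ?_⟩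
    obtain ⟨m, -, hs⟩ := ha ys hys b ⊤ hb ⟨hw, fun m hm => (ENat.top_ne_natCast m hm).elim⟩
    exact ⟨hs.1, fun h' => (h h').elim⟩

end SymWPHAA

/-! ### Counting the tasks -/

open Finset in
/-- The tasks with at most `k` pebbles whose set of states is nonempty and contains the state in the
purpose. -/
def tasks (Q : Type*) [Fintype Q] [DecidableEq Q] (k : ℕ) : Finset (SymWPHAA.Task Q) :=
  range (k + 1) ×ˢ univ ×ˢ
    (univ : Finset Q).powerset.sigma fun W => if #W = 0 then ∅ else insertNone W

open Finset in
theorem card_tasks_le (Q : Type*) [Fintype Q] [DecidableEq Q] [Nonempty Q] (k : ℕ) :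
    #(tasks Q k) ≤ 2 ^ (Fintype.card Q ^ 2 * (k + 1)) := by
  have hcard : #(tasks Q k) = (k + 1) * (Fintype.card Q *
      ∑ m ∈ range (Fintype.card Q + 1), (Fintype.card Q).choose m * if m = 0 then 0 else m + 1) := by
    have h := Finset.sum_powerset_apply_card (x := (univ : Finset Q))
      (fun m => if m = 0 then 0 else m + 1)
    simp only [card_univ, smul_eq_mul] at h
    rw [tasks, card_product, card_product, card_range, card_univ, card_sigma, ← h]
    congr 2
    refine sum_congr rfl fun W _ => ?_
    split_ifs
    · exact card_empty
    · exact card_insertNone W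
  have hn : 0 < Fintype.card Q := Fintype.card_pos
  have hbase : Fintype.card Q * (∑ m ∈ range (Fintype.card Q + 1),
      (Fintype.card Q).choose m * if m = 0 then 0 else m + 1) ≤ 2 ^ Fintype.card Q ^ 2 := by
    generalize Fintype.card Q = n at hn
    -- The crude estimate of the sum by `2 ^ n * (n + 1)` is good enough only for `n ≥ 3`.
    obtain rfl | rfl | hn3 : n = 1 ∨ n = 2 ∨ 3 ≤ n := by omega
    · decide
    · decide
    · calc n * (∑ m ∈ range (n + 1), n.choose m * if m = 0 then 0 else m + 1)
          ≤ n * (∑ m ∈ range (n + 1), n.choose m * (n + 1)) := by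
            gcongr with m hm
            rw [mem_range] at hm
            split_ifs <;> omega
        _ = n * (2 ^ n * (n + 1)) := by rw [← sum_mul, Nat.sum_range_choose]
        _ ≤ 2 ^ (n - 1) * (2 ^ n * 2 ^ n) := by
            have h1 : n < 2 ^ n := Nat.lt_two_pow_self
            have h2 : n - 1 < 2 ^ (n - 1) := Nat.lt_two_pow_self
            gcongr <;> omega
        _ ≤ 2 ^ n ^ 2 := by
            rw [← pow_add, ← pow_add]
            refine Nat.pow_le_pow_right two_pos ?_
            have : 3 * n ≤ n ^ 2 := by nlinarith
            omega
  rw [hcard, pow_mul, pow_succ]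
  refine Nat.mul_le_mul ?_ hbase
  calc k + 1 ≤ 2 ^ k := Nat.lt_two_pow_self
    _ ≤ (2 ^ Fintype.card Q ^ 2) ^ k :=
      Nat.pow_le_pow_left (Nat.le_self_pow (by positivity) 2) k

/-! ### The tree of chosen children -/

section SelTree

variable {Q S : Type*}

/-- The node of the original tree that a node of the new tree stands for, when the child number `j`
of a node standing for `x` stands for the child number `f x j` of `x`. -/
def trace (f : Node → ℕ → ℕ) : Node → Node
  | [] => []
  | j :: y => f (trace f y) j :: trace f y

/-- The nodes of the new tree: a node has `N` children if the node of `t` it stands for has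
children, and no children otherwise. -/
def IsSelNode (t : LTree S) (f : Node → ℕ → ℕ) (N : ℕ) : Node → Prop
  | [] => True
  | j :: y => IsSelNode t f N y ∧ j < N ∧ (t.children (trace f y)).Nonempty

/-- The tree of the children of `t` that are chosen by `f`.  The same child may be chosen several
times, so the new tree need not be a part of `t`. -/
def selTree (t : LTree S) (f : Node → ℕ → ℕ) (N : ℕ) : LTree S where
  nodes := {y | IsSelNode t f N y}
  label y := t.label (trace f y)
  root_mem := trivial
  parent_mem _ _ h := h.1
  sibling_mem _ _ _ h hlt := ⟨h.1, hlt.trans h.2.1, h.2.2⟩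

theorem selTree_degree_le (t : LTree S) (f : Node → ℕ → ℕ) (N : ℕ) (y : Node) :
    (selTree t f N).degree y ≤ N := by
  have hsub : (selTree t f N).children y ⊆ (fun j => j :: y) '' (Finset.range N : Set ℕ) := by
    rintro _ ⟨hm, j, rfl⟩
    have hm' : IsSelNode t f N (j :: y) := hm
    exact ⟨j, by simpa using hm'.2.1, rfl⟩
  calc (selTree t f N).degree y ≤ _ := Set.encard_le_encard hsub
    _ ≤ (Finset.range N : Set ℕ).encard := Set.encard_image_le _ _
    _ = N := by rw [Set.encard_coe_eq_coe_finsetCard, Finset.card_range]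

theorem length_trace (f : Node → ℕ → ℕ) (y : Node) : (trace f y).length = y.length := by
  induction y with
  | nil => rfl
  | cons j y ih => simp [trace, ih]

/-- The configuration on the original tree that a configuration on the new tree stands for. -/
def Config.trace (f : Node → ℕ → ℕ) (D : Config Q) : Config Q :=
  ⟨D.state, PebbleTree.trace f D.pos, D.pebbles.map (PebbleTree.trace f)⟩

theorem low_map_trace (f : Node → ℕ → ℕ) {x : Node} {ys : List Node} (h : Low x ys) :
    Low (trace f x) (ys.map (trace f)) := by
  cases ys with
  | nil => simp [Low]
  | cons y ys => simpa [Low, length_trace] using h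

/-- Although different nodes may stand for the same one, the pebble on the current node is
recognized, since it lies on the path to the current node. -/
theorem Inside.onPebble_trace {u : Node} {D : Config Q} (h : Inside u D) (f : Node → ℕ → ℕ) :
    (D.trace f).onPebble = D.onPebble := by
  obtain ⟨q, x, l⟩ := D
  cases l with
  | nil => rfl
  | cons y l =>
    have hy : y <:+ x := (List.isChain_cons_cons.1 h.2.1).1
    have : trace f y = trace f x ↔ y = x := by
      refine ⟨fun he => hy.eq_of_length ?_, fun he => by rw [he]⟩
      rw [← length_trace f, he, length_trace]
    simp [Config.onPebble, Config.trace, this]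

/-- The configurations that can occur in a run of an automaton with `k` pebbles. -/
def Legit (k : ℕ) (t : LTree S) (D : Config Q) : Prop :=
  Inside [] D ∧ D.pos ∈ t.nodes ∧ D.pebbles.length ≤ k

theorem Legit.step {k : ℕ} {A : SymWPAA k Q S} {t : LTree S} {D : Config Q} (h : Legit k t D)
    {L : Set (Config Q)} (hL : A.Step t D L) {c : Config Q} (hc : c ∈ L) : Legit k t c := by
  obtain ⟨hin, hpos, hlen⟩ := h
  have hlen' := hL.length_le hlen hc
  unfold SymWPAA.Step at hL
  split at hL
  · obtain ⟨-, rfl⟩ := hL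
    obtain rfl := Set.mem_singleton_iff.1 hc
    exact ⟨hin.drop _, hpos, hlen'⟩
  · obtain ⟨hp, rfl⟩ := hL
    obtain rfl := Set.mem_singleton_iff.1 hc
    exact ⟨hin.lift hp _, hpos, hlen'⟩
  · next α hα =>
    obtain ⟨Y, hY, -, -, -, hL⟩ := hL
    obtain ⟨d, p, hdp, z, hz, rfl⟩ := hL c hc
    refine ⟨?_, ?_, hlen'⟩
    · rcases hin.move t hz (SymWPAA.onPebble_of_up_mem A hα (hY hdp)) p with h | ⟨a, h, -⟩
      · exact h
      · cases h
    · cases d with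
      | box => exact hz.1
      | dia => exact hz.1
      | stay => obtain rfl := hz; exact hpos
      | root => obtain ⟨rfl, -⟩ := hz; exact hpos
      | up => obtain ⟨c, hc⟩ := hz; exact t.parent_mem _ c (hc ▸ hpos)

end SelTree

namespace SymWPHAA

variable {k : ℕ} {Q S : Type*}

/-- For every node with children and every task that can occur there, `f` chooses a best child among
its first `N` choices. -/
structure IsSelection (A : SymWPHAA k Q S) (t : LTree S) (f : Node → ℕ → ℕ) (N : ℕ) : Prop where
  mem : ∀ x, (t.children x).Nonempty → ∀ j, f x j :: x ∈ t.nodes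
  pos : 0 < N
  best : ∀ x, (t.children x).Nonempty → ∀ i ≤ k, ∀ p W o, W.Nonempty → (∀ p' ∈ o, p' ∈ W) →
    ∃ j < N, A.IsBest t x (i, p, ⟨W, o⟩) (f x j)

theorem exists_isSelection [Fintype Q] (A : SymWPHAA k Q S) (t : LTree S) :
    ∃ f, A.IsSelection t f (2 ^ (Fintype.card Q ^ 2 * (k + 1))) := by
  classical
  have : Nonempty Q := ⟨A.init⟩
  obtain ⟨e⟩ := Function.Embedding.nonempty_of_card_le
    (α := tasks Q k) (β := Fin (2 ^ (Fintype.card Q ^ 2 * (k + 1))))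
    (by simpa using card_tasks_le Q k)
  have hf : ∀ x j, ∃ a, (t.children x).Nonempty → a :: x ∈ t.nodes ∧
      ∀ κ : tasks Q k, (e κ).1 = j → A.IsBest t x κ.1 a := by
    intro x j
    by_cases hx : (t.children x).Nonempty
    · by_cases hj : ∃ κ, (e κ).1 = j
      · obtain ⟨κ, rfl⟩ := hj
        obtain ⟨a, ha, hbest⟩ := A.exists_isBest t hx κ.1
        refine ⟨a, fun _ => ⟨ha, fun κ' hκ' => ?_⟩⟩
        rw [e.injective (Fin.ext hκ')]
        exact hbest
      · obtain ⟨_, hm, a, rfl⟩ := hx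
        exact ⟨a, fun _ => ⟨hm, fun κ hκ => (hj ⟨κ, hκ⟩).elim⟩⟩
    · exact ⟨0, fun h => (hx h).elim⟩
  choose f hf using hf
  refine ⟨f, fun x hx j => (hf x j hx).1, by positivity, ?_⟩
  intro x hx i hi p W o hW ho
  have hmem : ((i, p, ⟨W, o⟩) : Task Q) ∈ tasks Q k := by
    simp only [tasks, Finset.mem_product, Finset.mem_range, Finset.mem_univ, true_and,
      Finset.mem_sigma, Finset.powerset_univ, if_neg (Finset.card_pos.2 hW).ne',
      Finset.mem_insertNone]
    exact ⟨by omega, ho⟩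
  exact ⟨_, (e ⟨_, hmem⟩).2, (hf x _ hx).2 ⟨_, hmem⟩ rfl⟩

theorem transAt_selTree (A : SymWPAA k Q S) (t : LTree S) (f : Node → ℕ → ℕ) (N : ℕ)
    {u : Node} {D : Config Q} (hD : Inside u D) :
    A.transAt (selTree t f N) D = A.transAt t (D.trace f) := by
  unfold SymWPAA.transAt
  rw [hD.onPebble_trace f]
  rfl

/-- A winning step on `t` gives a step on the tree of chosen children.  Each of its configurations
either stands for one in the given step, or comes from redirecting a `◇`-move: it is then still
winning and as close to success, and the move leaves the current part if that is universal. -/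
theorem WinStep.selTree [Finite Q] {A : SymWPHAA k Q S} {t : LTree S} {f : Node → ℕ → ℕ}
    {N : ℕ} (hf : A.IsSelection t f N) {D : Config Q} (hD : Legit k (selTree t f N) D)
    {L : Set (Config Q)} (hL : A.WinStep t (D.trace f) L) (M : ℕ) :
    ∃ L', A.Good (PebbleTree.selTree t f N) D L' ∧ ∀ D' ∈ L', D'.trace f ∈ L ∨
      ∃ c ∈ L, c.state = D'.state ∧ A.Win t (D'.trace f) ∧
        (A.kind (A.part D.state) = Kind.universal → A.part D'.state ≠ A.part D.state) ∧
        ((∃ n < M, A.SucceedsIn t n c) → ∃ n < M, A.SucceedsIn t n (D'.trace f)) := by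
  classical
  have := Fintype.ofFinite Q
  have hwin := hL.win
  obtain ⟨⟨hs, h0⟩, hLwin⟩ := hL
  have htr := transAt_selTree A.toSymWPAA t f N hD.1
  obtain ⟨q, y, l⟩ := D
  unfold SymWPAA.Step at hs
  split at hs
  · next p hp =>
    obtain ⟨hlt, rfl⟩ := hs
    refine ⟨{⟨p, y, y :: l⟩}, ⟨?_, fun h => (Set.singleton_ne_empty _ h).elim⟩, ?_⟩
    · unfold SymWPAA.Step
      rw [htr, hp]
      exact ⟨by simpa [Config.trace] using hlt, rfl⟩
    · rintro _ rfl
      exact Or.inl rfl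
  · next p hp =>
    obtain ⟨hhead, rfl⟩ := hs
    refine ⟨{⟨p, y, l.tail⟩}, ⟨?_, fun h => (Set.singleton_ne_empty _ h).elim⟩, ?_⟩
    · unfold SymWPAA.Step
      rw [htr, hp]
      refine ⟨?_, rfl⟩
      have hon := hD.1.onPebble_trace f
      rw [show (Config.trace f ⟨q, y, l⟩).onPebble = true from decide_eq_true hhead] at hon
      exact of_decide_eq_true hon.symm
    · rintro _ rfl
      exact Or.inl (by simp [Config.trace])
  · next α hα =>
    obtain ⟨Y, hY, hsat, hone, hbox, hLY⟩ := hs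
    let R : Config Q → Prop := fun D' => D'.trace f ∈ L ∨
      ∃ c ∈ L, c.state = D'.state ∧ A.Win t (D'.trace f) ∧
        (A.kind (A.part q) = Kind.universal → A.part D'.state ≠ A.part q) ∧
        ((∃ n < M, A.SucceedsIn t n c) → ∃ n < M, A.SucceedsIn t n (D'.trace f))
    have hone' : ∀ d p, (d, p) ∈ Y → d ≠ Dir.box →
        ∃ z ∈ targets (PebbleTree.selTree t f N) y d, R ⟨p, z, l⟩ := by
      intro d p hdp hd
      obtain ⟨z, hz, hzL⟩ := hone d p hdp hd
      cases d with
      | box => exact (hd rfl).elim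
      | stay =>
        obtain rfl := hz
        exact ⟨y, rfl, Or.inl hzL⟩
      | root =>
        obtain ⟨rfl, hz⟩ := hz
        refine ⟨y, ⟨rfl, ?_⟩, Or.inl hzL⟩
        rw [← List.length_eq_zero_iff, ← length_trace f]
        exact List.length_eq_zero_iff.2 hz
      | up =>
        obtain ⟨c, hz⟩ := hz
        cases y with
        | nil => cases hz
        | cons j y =>
          obtain ⟨-, rfl⟩ := List.cons.inj hz
          exact ⟨y, ⟨j, rfl⟩, Or.inl hzL⟩
      | dia =>
        obtain ⟨hz, b, rfl⟩ := hz
        have hne : (t.children (PebbleTree.trace f y)).Nonempty := ⟨_, hz, b, rfl⟩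
        let W := Finset.univ.filter fun p =>
          A.Win t ⟨p, PebbleTree.trace f y, l.map (PebbleTree.trace f)⟩
        have hprof : A.HasProfile t (PebbleTree.trace f y) l.length W
            (l.map (PebbleTree.trace f)) :=
          ⟨low_map_trace f hD.1.low, by simp, fun p => by simp [W]⟩
        obtain ⟨o, ho, hred⟩ := A.exists_redirect hprof hz (hLwin _ hzL) M
        obtain ⟨j, hj, hbest⟩ := hf.best _ hne l.length hD.2.2 p W o
          ⟨q, (hprof.2.2 q).2 hwin⟩ ho
        obtain ⟨h1, h2⟩ := hred _ hbest
        exact ⟨j :: y, ⟨⟨hD.2.1, hj, hne⟩, j, rfl⟩, Or.inr ⟨_, hzL, rfl, h1,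
          fun hk he => A.universal_no_dia _ _ _ α p hk hα he (hY hdp), h2⟩⟩
    have hbox' : ∀ p, (Dir.box, p) ∈ Y → ∀ z ∈ targets (PebbleTree.selTree t f N) y Dir.box,
        R ⟨p, z, l⟩ := by
      rintro p hp _ ⟨hz, j, rfl⟩
      have hz' : IsSelNode t f N (j :: y) := hz
      exact Or.inl (hbox p hp _ ⟨hf.mem _ hz'.2.2 j, _, rfl⟩)
    refine ⟨{D' | R D' ∧ ∃ d p, (d, p) ∈ Y ∧ ∃ z ∈ targets (PebbleTree.selTree t f N) y d,
      D' = ⟨p, z, l⟩}, ⟨?_, ?_⟩, fun D' hD' => hD'.1⟩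
    · unfold SymWPAA.Step
      rw [htr, hα]
      refine ⟨Y, hY, hsat, fun d p hdp hd => ?_, fun p hp z hz => ?_, fun c hc => hc.2⟩
      · obtain ⟨z, hz, hR⟩ := hone' d p hdp hd
        exact ⟨z, hz, hR, d, p, hdp, z, hz, rfl⟩
      · exact ⟨hbox' p hp z hz, _, p, hp, z, hz, rfl⟩
    · intro he
      have hno : ∀ d p z, (d, p) ∈ Y → z ∈ targets (PebbleTree.selTree t f N) y d →
          ¬R ⟨p, z, l⟩ := fun d p z hdp hz hR =>
        Set.eq_empty_iff_forall_notMem.1 he _ ⟨hR, d, p, hdp, z, hz, rfl⟩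
      obtain ⟨β, hβ, h⟩ := h0 (by
        rw [Set.eq_empty_iff_forall_notMem]
        intro c hc
        obtain ⟨d, p, hdp, z, hz, rfl⟩ := hLY c hc
        by_cases hd : d = Dir.box
        · -- The current node has a child in `t`, so one of its children was chosen.
          subst hd
          have hch : (0 :: y) ∈ targets (PebbleTree.selTree t f N) y Dir.box :=
            ⟨⟨hD.2.1, hf.pos, ⟨z, hz⟩⟩, 0, rfl⟩
          exact hno _ p _ hdp hch (hbox' p hdp _ hch)
        · obtain ⟨z', hz', hR⟩ := hone' d p hdp hd
          exact hno _ p _ hdp hz' hR)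
      exact ⟨β, htr.trans hβ, h⟩

/-! ### The run on the tree of chosen children -/

theorem infStates_inter_nonempty [Finite Q] (s : ℕ → Q) (G : Set Q)
    (h : ∀ N, ∃ n, N ≤ n ∧ s n ∈ G) : (infStates s ∩ G).Nonempty := by
  have := Fintype.ofFinite Q
  by_contra! hcon
  have hq : ∀ q, ∃ N, ∀ n, N ≤ n → s n = q → q ∉ G := by
    intro q
    by_cases hqG : q ∈ G
    · have hq : q ∉ infStates s := fun hq => Set.eq_empty_iff_forall_notMem.1 hcon q ⟨hq, hqG⟩
      simp only [infStates, Set.mem_ofPred_eq, not_forall, not_exists, not_and] at hq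
      obtain ⟨N, hN⟩ := hq
      exact ⟨N, fun n hn he => (hN n hn he).elim⟩
    · exact ⟨0, fun _ _ _ => hqG⟩
  choose N hN using hq
  obtain ⟨n, hn, hG⟩ := h (Finset.univ.sup N)
  exact hN (s n) n ((Finset.le_sup (Finset.mem_univ _)).trans hn) rfl hG

/-- If the original tree is accepted, so is the tree of chosen children.  The new run follows runs
on the original tree through the universal parts; in the existential parts, where moves are
redirected, every step visits `G` or comes closer to success. -/
theorem win_selTree [Finite Q] (A : SymWPHAA k Q S) {t : LTree S} {f : Node → ℕ → ℕ} {N : ℕ}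
    (hf : A.IsSelection t f N) (hw : A.Win t ⟨A.init, [], []⟩) :
    A.Win (selTree t f N) ⟨A.init, [], []⟩ := by
  have hne : Nonempty (LTree (Config Q)) := ⟨hw.choose⟩
  have hrun : ∀ C, ∃ r, A.Win t C → A.AcceptingFrom t C r := fun C => by
    by_cases h : A.Win t C
    · exact ⟨h.choose, fun _ => h.choose_spec⟩
    · exact ⟨hne.some, fun h' => (h h').elim⟩
  choose run hrun using hrun
  -- A vertex `(D, C, v)` is a configuration on the new tree and a node `v` of the run from `C`.
  let V := {m : Config Q × Config Q × Node // Legit k (selTree t f N) m.1 ∧ A.Win t m.2.1 ∧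
    m.2.2 ∈ (run m.2.1).nodes ∧ (run m.2.1).label m.2.2 = m.1.trace f}
  let st : V → Q := fun m => m.1.1.state
  let rank : V → ℕ := fun m => sInf {n | A.SucceedsIn t n (m.1.1.trace f)}
  let E : V → V → Prop := fun m m' =>
    st m' ∈ {p | A.le (A.part p) (A.part (st m)) ∧
      (A.kind (A.part (st m)) = Kind.transient → A.part p ≠ A.part (st m))} ∧
    (A.part (st m') = A.part (st m) →
      (A.kind (A.part (st m)) = Kind.existential → st m' ∈ A.G ∨ rank m' < rank m) ∧
      (A.kind (A.part (st m)) = Kind.universal →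
        m'.1.2.1 = m.1.2.1 ∧ m'.1.2.2 ∈ (run m.1.2.1).children m.1.2.2))
  have hroot : Legit k (selTree t f N) (⟨A.init, [], []⟩ : Config Q) :=
    ⟨⟨List.suffix_rfl, List.isChain_singleton _, by simp⟩, trivial, Nat.zero_le k⟩
  refine A.win_of_graph_aux (selTree t f N) (V := V) (fun m => m.1.1) E ?_ ?_
    ⟨(⟨A.init, [], []⟩, ⟨A.init, [], []⟩, []), hroot, hw, (run _).root_mem, (hrun _ hw).start⟩
  · rintro ⟨⟨D, C, v⟩, hD, hC, hv, hlab⟩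
    have hws := (hrun C hC).winStep hv
    dsimp only at hD hC hv hlab
    rw [hlab] at hws
    have hdown : ∀ {L'}, A.Good (selTree t f N) D L' → ∀ D' ∈ L',
        D'.state ∈ {p | A.le (A.part p) (A.part D.state) ∧
          (A.kind (A.part D.state) = Kind.transient → A.part p ≠ A.part D.state)} :=
      fun hL' D' hD' => ⟨A.descend _ _ _ _ (hL'.1.state_mem hD'),
        fun hk => A.transient_leave _ _ _ hk _ (hL'.1.state_mem hD')⟩
    by_cases hk : A.kind (A.part D.state) = Kind.existential
    · have hsucc := Nat.sInf_mem (hws.win.exists_succeedsIn hk)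
      obtain ⟨L, hL, hprog⟩ := SucceedsIn.exists_step hsucc
      obtain ⟨L', hL', hD'⟩ := hL.selTree hf hD (sInf {n | A.SucceedsIn t n (D.trace f)})
      refine ⟨L', hL', fun D' h => ?_⟩
      have hres : A.Win t (D'.trace f) ∧ (A.part D'.state = A.part D.state →
          D'.state ∈ A.G ∨ ∃ m < sInf {n | A.SucceedsIn t n (D.trace f)},
            A.SucceedsIn t m (D'.trace f)) := by
        rcases hD' D' h with hin | ⟨c, hc, hst, hwin, -, hclose⟩
        · exact ⟨hL.2 _ hin, fun hp => hprog _ hin hp⟩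
        · refine ⟨hwin, fun hp => ?_⟩
          rw [← hst] at hp ⊢
          exact (hprog c hc hp).imp_right hclose
      refine ⟨⟨(D', D'.trace f, []), hD.step hL'.1 h, hres.1, (run _).root_mem,
        (hrun _ hres.1).start⟩, ⟨hdown hL' D' h, fun hp => ⟨fun _ => ?_, fun hk' => ?_⟩⟩, rfl⟩
      · refine (hres.2 hp).imp_right ?_
        rintro ⟨m, hm, hs⟩
        exact lt_of_le_of_lt (Nat.sInf_le hs) hm
      · rw [show A.kind (A.part D.state) = Kind.universal from hk'] at hk
        cases hk
    · obtain ⟨L', hL', hD'⟩ := hws.selTree hf hD 0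
      refine ⟨L', hL', fun D' h => ?_⟩
      rcases hD' D' h with ⟨v', hv', he⟩ | ⟨c, -, -, hwin, huniv, -⟩
      · exact ⟨⟨(D', C, v'), hD.step hL'.1 h, hC, hv'.1, he⟩,
          ⟨hdown hL' D' h, fun _ => ⟨fun hk' => (hk hk').elim, fun _ => ⟨rfl, hv'⟩⟩⟩, rfl⟩
      · exact ⟨⟨(D', D'.trace f, []), hD.step hL'.1 h, hwin, (run _).root_mem,
          (hrun _ hwin).start⟩, ⟨hdown hL' D' h, fun hp =>
            ⟨fun hk' => (hk hk').elim, fun hk' => (huniv hk' hp).elim⟩⟩, rfl⟩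
  · intro π hπ
    obtain ⟨K, hK⟩ := A.exists_trapped (fun n => st (π n)) fun n => (hπ n).1.1
    have hsame : ∀ n, K ≤ n → A.part (st (π (n + 1))) = A.part (st (π n)) := fun n hn =>
      (hK (n + 1) (by omega)).trans (hK n hn).symm
    rcases hkind : A.kind (A.part (st (π K))) with _ | _ | _
    · refine ⟨_, ⟨K, hK⟩, Or.inl ⟨hkind, infStates_inter_nonempty _ _ ?_⟩⟩
      by_contra! hno
      obtain ⟨M, hM⟩ := hno
      have hdec : ∀ n, rank (π (n + (K + M))) + n ≤ rank (π (K + M)) := by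
        intro n
        induction n with
        | zero => simp
        | succ n ih =>
          have hn : K ≤ n + (K + M) := by omega
          have := ((hπ (n + (K + M))).2 (hsame _ hn)).1 (by rw [hK _ hn]; exact hkind)
          have := this.resolve_left (hM _ (by omega))
          rw [show n + 1 + (K + M) = n + (K + M) + 1 by omega]
          omega
      have := hdec (rank (π (K + M)) + 1)
      omega
    · have hstep : ∀ n, (π (n + 1 + K)).1.2.1 = (π (n + K)).1.2.1 ∧
          (π (n + 1 + K)).1.2.2 ∈ (run (π (n + K)).1.2.1).children (π (n + K)).1.2.2 := by
        intro n
        have hn : K ≤ n + K := by omega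
        rw [show n + 1 + K = n + K + 1 by omega]
        exact ((hπ (n + K)).2 (hsame _ hn)).2 (by rw [hK _ hn]; exact hkind)
      have hconst : ∀ n, (π (n + K)).1.2.1 = (π K).1.2.1 := by
        intro n
        induction n with
        | zero => simp
        | succ n ih => exact (hstep n).1.trans ih
      have hacc := (hrun _ (π K).2.2.1).path_from _ (fun n => (π (n + K)).1.2.2) rfl fun n => by
        have := (hstep n).2
        rwa [hconst n] at this
      rw [← A.acceptsSeq_add_iff _ K]
      have hst : ∀ n, ((run (π K).1.2.1).label (π (n + K)).1.2.2).state =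
          (π (n + K)).1.1.state := fun n => by
        have := (π (n + K)).2.2.2.2
        rw [hconst n] at this
        rw [this]
        rfl
      simp only [hst] at hacc
      exact hacc
    · exact ((hπ K).1.2 hkind (hsame K le_rfl)).elim

theorem mem_language_iff (A : SymWPHAA k Q S) (t : LTree S) :
    t ∈ A.language ↔ A.Win t ⟨A.init, [], []⟩ :=
  ⟨fun ⟨r, h⟩ => ⟨r, h.isRun.start, h.isRun.step, h.infinite_path, h.finite_path⟩,
    fun ⟨r, h⟩ => ⟨r, ⟨h.start, h.step⟩, h.infinite_path, h.finite_path⟩⟩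

end SymWPHAA

end PebbleTree

theorem mainTheorem8 {Q S : Type*} [Fintype Q] [Finite S] (k : ℕ)
    (A : PebbleTree.SymWPHAA k Q S) (hA : A.language.Nonempty) :
    ∃ t ∈ A.language, ∀ x ∈ t.nodes,
      t.degree x ≤ ((2 ^ (Fintype.card Q ^ 2 * (k + 1)) : ℕ) : ℕ∞) := by
  obtain ⟨t, ht⟩ := hA
  obtain ⟨f, hf⟩ := A.exists_isSelection t
  exact ⟨PebbleTree.selTree t f _, (A.mem_language_iff _).2 (A.win_selTree hf
    ((A.mem_language_iff t).1 ht)), fun x _ => PebbleTree.selTree_degree_le t f _ x⟩
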